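/- Work in the two-sorted language $\mathsf{L}_2$ of second-order arithmetic, with signature $\langle 0,1,+,\times,<,=_{\mathbb N},\in\rangle$, equality of sets being extensional. $\mathsf{RCA}_0$ consists of the axioms of a discrete ordered semiring, $\Sigma^0_1$ induction and $\Delta^0_1$ comprehension; $\mathsf{WKL}_0$ is $\mathsf{RCA}_0$ together with weak König's lemma, "every infinite subtree of $2^{<\mathbb N}$ has an infinite path". A family of sets is a sequence $A=\langle A_i : i\in\mathbb N\rangle$ of subsets of $\mathbb N$ (coded by one set through a pairing function); it is nontrivial if some $A_i$ is nonempty. A family $B$ is a subfamily of $A$ if $(\forall i)(\exists j)[B_i=A_j]$. A family has the $\overline{D}_2$ intersection property if any two of its members that are distinct as sets have nonempty intersection. A subfamily $B$ of $A$ with the $\overline{D}_2$ intersection property is maximal if every subfamily $C$ of $A$ with that property of which $B$ is a subfamily is itself a subfamily of $B$. The principle $\overline{D}_2\mathsf{IP}$ is the $\mathsf{L}_2$-sentence "every nontrivial family of sets has a maximal subfamily with the $\overline{D}_2$ intersection property". **Corollary.** $\overline{D}_2\mathsf{IP}$ is not provable in $\mathsf{WKL}_0$. Moreover, there is an $\omega$-model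 $\mathscr M$ of $\mathsf{WKL}_0$ such that every set in $\mathscr M$ has hyperimmune-free Turing degree (every function computable from it is dominated by a computable function) and $\overline{D}_2\mathsf{IP}$ is false in $\mathscr M$. -/

import Mathlib

namespace SOA

/-! ## The language of second-order arithmetic

Signature `0, 1, +, ×, <, =` (on numbers) and `∈`. Syntax is well scoped, with de Bruijn
indices: `Term n` has number variables `0, …, n - 1`, and `Formula n m` has in addition set
variables `0, …, m - 1`. A quantifier binds index `0` and shifts the other indices of its sort. -/

/-- Number terms. -/
inductive Term : ℕ → Type
  | var {n : ℕ} (i : Fin n) : Term n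
  | zero {n : ℕ} : Term n
  | one {n : ℕ} : Term n
  | add {n : ℕ} (t u : Term n) : Term n
  | mul {n : ℕ} (t u : Term n) : Term n

/-- Two-sorted formulas. The other connectives and quantifiers are defined classically below. -/
inductive Formula : ℕ → ℕ → Type
  | falsum {n m : ℕ} : Formula n m
  | eq {n m : ℕ} (t u : Term n) : Formula n m
  | lt {n m : ℕ} (t u : Term n) : Formula n m
  | mem {n m : ℕ} (t : Term n) (X : Fin m) : Formula n m
  | imp {n m : ℕ} (φ ψ : Formula n m) : Formula n m
  | allN {n m : ℕ} (φ : Formula (n + 1) m) : Formula n m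
  | allS {n m : ℕ} (φ : Formula n (m + 1)) : Formula n m

/-- Sentences: no free variables of either sort. -/
abbrev Sentence : Type := Formula 0 0

/-- Theories: sets of sentences. -/
abbrev Theory : Type := Set Sentence

instance (n : ℕ) : Zero (Term n) := ⟨Term.zero⟩
instance (n : ℕ) : One (Term n) := ⟨Term.one⟩
instance (n : ℕ) : Add (Term n) := ⟨Term.add⟩
instance (n : ℕ) : Mul (Term n) := ⟨Term.mul⟩

namespace Term

/-- Simultaneous substitution of terms for variables. -/
def subst {n : ℕ} : Term n → {k : ℕ} → (Fin n → Term k) → Term k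
  | .var i, _, s => s i
  | .zero, _, _ => .zero
  | .one, _, _ => .one
  | .add t u, _, s => .add (t.subst s) (u.subst s)
  | .mul t u, _, s => .mul (t.subst s) (u.subst s)

/-- Weakening by a fresh number variable of index `0`. -/
def wk {n : ℕ} (t : Term n) : Term (n + 1) := t.subst fun i => .var i.succ

/-- Value of a term in the standard natural numbers. -/
def eval {n : ℕ} (v : Fin n → ℕ) : Term n → ℕ
  | .var i => v i
  | .zero => 0
  | .one => 1
  | .add t u => t.eval v + u.eval v
  | .mul t u => t.eval v * u.eval v

end Term

namespace Formula

def neg {n m : ℕ} (φ : Formula n m) : Formula n m := imp φ falsum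
def and {n m : ℕ} (φ ψ : Formula n m) : Formula n m := neg (imp φ (neg ψ))
def or {n m : ℕ} (φ ψ : Formula n m) : Formula n m := imp (neg φ) ψ
def iff {n m : ℕ} (φ ψ : Formula n m) : Formula n m := and (imp φ ψ) (imp ψ φ)
def exN {n m : ℕ} (φ : Formula (n + 1) m) : Formula n m := neg (allN (neg φ))
def exS {n m : ℕ} (φ : Formula n (m + 1)) : Formula n m := neg (allS (neg φ))

end Formula

infixr:25 " ⟶ₗ " => Formula.imp
infix:27 " ⟷ₗ " => Formula.iff
infixr:30 " ∨ₗ " => Formula.or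
infixr:35 " ∧ₗ " => Formula.and
infix:50 " =ₗ " => Formula.eq
infix:50 " <ₗ " => Formula.lt
infix:50 " ∈ₗ " => Formula.mem

namespace Formula

/-- Capture-avoiding simultaneous substitution: terms for number variables, set variables for
set variables. -/
def subst {n m : ℕ} : Formula n m → {k l : ℕ} → (Fin n → Term k) → (Fin m → Fin l) → Formula k l
  | .falsum, _, _, _, _ => .falsum
  | .eq t u, _, _, s, _ => .eq (t.subst s) (u.subst s)
  | .lt t u, _, _, s, _ => .lt (t.subst s) (u.subst s)
  | .mem t X, _, _, s, r => .mem (t.subst s) (r X)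
  | .imp φ ψ, _, _, s, r => .imp (φ.subst s r) (ψ.subst s r)
  | .allN φ, _, _, s, r => .allN (φ.subst (Fin.cons (.var 0) fun i => (s i).wk) r)
  | .allS φ, _, _, s, r => .allS (φ.subst s (Fin.cons 0 fun i => (r i).succ))

/-- Weakening by a fresh number variable of index `0`. -/
def wkN {n m : ℕ} (φ : Formula n m) : Formula (n + 1) m := φ.subst (fun i => .var i.succ) id

/-- Weakening by a fresh set variable of index `0`. -/
def wkS {n m : ℕ} (φ : Formula n m) : Formula n (m + 1) := φ.subst .var Fin.succ

/-- Instance `φ(t)` at the number variable of index `0`. -/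
def instN {n m : ℕ} (φ : Formula (n + 1) m) (t : Term n) : Formula n m :=
  φ.subst (Fin.cons t .var) id

/-- Instance `φ(X)` at the set variable of index `0`. -/
def instS {n m : ℕ} (φ : Formula n (m + 1)) (X : Fin m) : Formula n m :=
  φ.subst .var (Fin.cons X id)

/-- Instance `φ(x + 1)`, where `x` is the number variable of index `0`. -/
def instSucc {n m : ℕ} (φ : Formula (n + 1) m) : Formula (n + 1) m :=
  φ.subst (Fin.cons (.var 0 + 1) fun i => .var i.succ) id

/-- Universal closure over the number variables. -/
def closeN {m : ℕ} : {n : ℕ} → Formula n m → Formula 0 m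
  | 0, φ => φ
  | _ + 1, φ => closeN (allN φ)

/-- Universal closure over the set variables. -/
def closeS : {m : ℕ} → Formula 0 m → Sentence
  | 0, φ => φ
  | _ + 1, φ => closeS (allS φ)

/-- Universal closure. -/
def univClosure {n m : ℕ} (φ : Formula n m) : Sentence := closeS (closeN φ)

/-- A sentence, in the presence of (unused) free variables. -/
def ofSentence {n m : ℕ} (φ : Sentence) : Formula n m := φ.subst Fin.elim0 Fin.elim0

/-- Bounded (`Δ⁰₀`) formulas; set parameters are allowed. -/
inductive IsBounded : {n m : ℕ} → Formula n m → Prop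
  | falsum {n m : ℕ} : IsBounded (falsum : Formula n m)
  | eq {n m : ℕ} (t u : Term n) : IsBounded (eq t u : Formula n m)
  | lt {n m : ℕ} (t u : Term n) : IsBounded (lt t u : Formula n m)
  | mem {n m : ℕ} (t : Term n) (X : Fin m) : IsBounded (mem t X)
  | imp {n m : ℕ} {φ ψ : Formula n m} : IsBounded φ → IsBounded ψ → IsBounded (φ ⟶ₗ ψ)
  /-- The bounded quantifier `∀ x < t, φ`; the bound `t` does not mention `x`. -/
  | ball {n m : ℕ} (t : Term n) {φ : Formula (n + 1) m} :
      IsBounded φ → IsBounded (allN (Term.var 0 <ₗ t.wk ⟶ₗ φ))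

/-- `Σ⁰₁` formulas: `∃ x, θ` with `θ` bounded. -/
def IsSigma1 {n m : ℕ} (φ : Formula n m) : Prop :=
  ∃ θ : Formula (n + 1) m, IsBounded θ ∧ φ = exN θ

/-- `Π⁰₁` formulas: `∀ x, θ` with `θ` bounded. -/
def IsPi1 {n m : ℕ} (φ : Formula n m) : Prop :=
  ∃ θ : Formula (n + 1) m, IsBounded θ ∧ φ = allN θ

end Formula

open Formula

/-! ## Provability and `ω`-models -/

/-- Classical two-sorted natural deduction with equality on numbers: `Derives T Γ φ` says that
`φ` is derivable from axioms in `T` and hypotheses in `Γ`. -/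
inductive Derives (T : Theory) : {n m : ℕ} → List (Formula n m) → Formula n m → Prop
  | ax {n m : ℕ} {Γ : List (Formula n m)} {φ : Sentence} :
      φ ∈ T → Derives T Γ (ofSentence φ)
  | hyp {n m : ℕ} {Γ : List (Formula n m)} {φ : Formula n m} :
      φ ∈ Γ → Derives T Γ φ
  | impI {n m : ℕ} {Γ : List (Formula n m)} {φ ψ : Formula n m} :
      Derives T (φ :: Γ) ψ → Derives T Γ (φ ⟶ₗ ψ)
  | impE {n m : ℕ} {Γ : List (Formula n m)} {φ ψ : Formula n m} :
      Derives T Γ (φ ⟶ₗ ψ) → Derives T Γ φ → Derives T Γ ψ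
  | byContra {n m : ℕ} {Γ : List (Formula n m)} {φ : Formula n m} :
      Derives T (neg φ :: Γ) falsum → Derives T Γ φ
  | allNI {n m : ℕ} {Γ : List (Formula n m)} {φ : Formula (n + 1) m} :
      Derives T (Γ.map wkN) φ → Derives T Γ (allN φ)
  | allNE {n m : ℕ} {Γ : List (Formula n m)} {φ : Formula (n + 1) m} (t : Term n) :
      Derives T Γ (allN φ) → Derives T Γ (φ.instN t)
  | allSI {n m : ℕ} {Γ : List (Formula n m)} {φ : Formula n (m + 1)} :
      Derives T (Γ.map wkS) φ → Derives T Γ (allS φ)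
  | allSE {n m : ℕ} {Γ : List (Formula n m)} {φ : Formula n (m + 1)} (X : Fin m) :
      Derives T Γ (allS φ) → Derives T Γ (φ.instS X)
  | eqRefl {n m : ℕ} {Γ : List (Formula n m)} (t : Term n) :
      Derives T Γ (t =ₗ t)
  | eqSubst {n m : ℕ} {Γ : List (Formula n m)} (φ : Formula (n + 1) m) {t u : Term n} :
      Derives T Γ (t =ₗ u) → Derives T Γ (φ.instN t) → Derives T Γ (φ.instN u)

/-- The sentence `φ` is provable in the theory `T`. -/
def Provable (T : Theory) (φ : Sentence) : Prop := Derives T [] φ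

/-- Truth in the `ω`-model with collection of sets `M`, under assignments `v` and `V`: number
quantifiers range over the standard `ℕ`, set quantifiers range over `M`. -/
def Formula.Realize (M : Set (Set ℕ)) {n m : ℕ} :
    Formula n m → (Fin n → ℕ) → (Fin m → Set ℕ) → Prop
  | .falsum, _, _ => False
  | .eq t u, v, _ => t.eval v = u.eval v
  | .lt t u, v, _ => t.eval v < u.eval v
  | .mem t X, v, V => t.eval v ∈ V X
  | .imp φ ψ, v, V => φ.Realize M v V → ψ.Realize M v V
  | .allN φ, v, V => ∀ a : ℕ, φ.Realize M (Fin.cons a v) V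
  | .allS φ, v, V => ∀ X ∈ M, φ.Realize M v (Fin.cons X V)

/-- The sentence `φ` is true in the `ω`-model `M`. -/
def Satisfies (M : Set (Set ℕ)) (φ : Sentence) : Prop := φ.Realize M Fin.elim0 Fin.elim0

/-- `M` is an `ω`-model of the theory `T`. -/
def IsOmegaModel (M : Set (Set ℕ)) (T : Theory) : Prop := ∀ φ ∈ T, Satisfies M φ

/-! ## The systems `RCA₀` and `WKL₀` -/

/-- `t ≤ u`. -/
def leF {n m : ℕ} (t u : Term n) : Formula n m := (t <ₗ u) ∨ₗ (t =ₗ u)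

/-- The axioms of discrete ordered semirings (universal closures; the names `x`, `y`, `z` stand
for the variables of index `0`, `1`, `2`). -/
def discreteOrderedSemiring : Theory :=
  let x : Term 3 := .var 0
  let y : Term 3 := .var 1
  let z : Term 3 := .var 2
  let cl : Formula 3 0 → Sentence := univClosure
  { cl ((x + y) + z =ₗ x + (y + z)),
    cl (x + y =ₗ y + x),
    cl ((x * y) * z =ₗ x * (y * z)),
    cl (x * y =ₗ y * x),
    cl (x * (y + z) =ₗ x * y + x * z),
    cl (x + 0 =ₗ x),
    cl (x * 0 =ₗ 0),
    cl (x * 1 =ₗ x),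
    cl (x <ₗ y ∧ₗ y <ₗ z ⟶ₗ x <ₗ z),
    cl (neg (x <ₗ x)),
    cl (x <ₗ y ∨ₗ x =ₗ y ∨ₗ y <ₗ x),
    cl (x <ₗ y ⟶ₗ x + z <ₗ y + z),
    cl (0 <ₗ z ∧ₗ x <ₗ y ⟶ₗ x * z <ₗ y * z),
    cl (x <ₗ y ⟶ₗ exN (x.wk + .var 0 =ₗ y.wk)),
    cl (0 <ₗ 1),
    cl (0 <ₗ x ⟶ₗ leF 1 x),
    cl (leF 0 x) }

/-- The induction axiom for `φ(x, …)`, with all parameters universally quantified: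
`φ(0) ∧ ∀ x (φ(x) → φ(x + 1)) → ∀ x φ(x)`. -/
def inductionAxiom {n m : ℕ} (φ : Formula (n + 1) m) : Sentence :=
  univClosure (φ.instN 0 ∧ₗ allN (φ ⟶ₗ φ.instSucc) ⟶ₗ allN φ)

/-- The `Δ⁰₁` comprehension axiom for `φ(x, …)` and `ψ(x, …)`, with all parameters universally
quantified: `∀ x (φ(x) ↔ ψ(x)) → ∃ X ∀ x (x ∈ X ↔ φ(x))`, where `φ` does not mention `X`. -/
def comprehensionAxiom {n m : ℕ} (φ ψ : Formula (n + 1) m) : Sentence :=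
  univClosure (allN (φ ⟷ₗ ψ) ⟶ₗ exS (allN (.var 0 ∈ₗ 0 ⟷ₗ φ.wkS)))

/-- `RCA₀`: discrete ordered semirings, `Σ⁰₁` induction and `Δ⁰₁` comprehension. -/
def RCA0 : Theory :=
  discreteOrderedSemiring
    ∪ {σ | ∃ (n m : ℕ) (φ : Formula (n + 1) m), φ.IsSigma1 ∧ σ = inductionAxiom φ}
    ∪ {σ | ∃ (n m : ℕ) (φ ψ : Formula (n + 1) m),
        φ.IsSigma1 ∧ ψ.IsPi1 ∧ σ = comprehensionAxiom φ ψ}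

/-! Finite binary strings are coded by the positive numbers, bijectively: the empty string has
code `1`, and if `s` codes `σ` then `s + s` codes `σ⌢0` and `s + s + 1` codes `σ⌢1`. -/

/-- The code of `σ⌢0`, where `s` codes `σ`. -/
def child0 {n : ℕ} (s : Term n) : Term n := s + s

/-- The code of `σ⌢1`, where `s` codes `σ`. -/
def child1 {n : ℕ} (s : Term n) : Term n := s + s + 1

/-- `T ⊆ 2^{<ℕ}` is a tree: every element is a code, and `T` is closed under initial segments
(`σ⌢0 ∈ T` or `σ⌢1 ∈ T` implies `σ ∈ T`). -/
def binaryTree {m : ℕ} (T : Fin m) : Formula 0 m :=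
  allN (.var 0 ∈ₗ T ⟶ₗ 0 <ₗ .var 0) ∧ₗ
  allN (0 <ₗ .var 0 ∧ₗ (child0 (.var 0) ∈ₗ T ∨ₗ child1 (.var 0) ∈ₗ T) ⟶ₗ .var 0 ∈ₗ T)

/-- `X` is infinite: `∀ k ∃ s (k < s ∧ s ∈ X)`. -/
def infiniteSet {m : ℕ} (X : Fin m) : Formula 0 m :=
  allN (exN (.var 1 <ₗ .var 0 ∧ₗ .var 0 ∈ₗ X))

/-- `P` is an infinite path through `T`, given as the set of its finite initial segments: `P ⊆ T`,
`P` is itself a tree, `P` contains the empty string, and whenever `σ ∈ P`, exactly one of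
`σ⌢0`, `σ⌢1` is in `P`. -/
def infinitePath {m : ℕ} (P T : Fin m) : Formula 0 m :=
  allN (.var 0 ∈ₗ P ⟶ₗ .var 0 ∈ₗ T) ∧ₗ
  binaryTree P ∧ₗ
  1 ∈ₗ P ∧ₗ
  allN (.var 0 ∈ₗ P ⟶ₗ (child0 (.var 0) ∈ₗ P ⟷ₗ neg (child1 (.var 0) ∈ₗ P)))

/-- Weak König's lemma: every infinite subtree of `2^{<ℕ}` has an infinite path. -/
def weakKonigLemma : Sentence :=
  allS (binaryTree 0 ∧ₗ infiniteSet 0 ⟶ₗ exS (infinitePath 0 1))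

/-- `WKL₀`. -/
def WKL0 : Theory := RCA0 ∪ {weakKonigLemma}

/-! ## The `D̄₂` intersection principle

A family `⟨A_i : i ∈ ℕ⟩` is coded by the set `A` of all `(i, x)` with `x ∈ A_i`, through the
injective pairing `(i, x) = (i + x)² + i`. -/

/-- The pairing term `(i, x)`. -/
def pairT {n : ℕ} (i x : Term n) : Term n := (i + x) * (i + x) + i

/-- `x ∈ A_i`. -/
def memAt {n m : ℕ} (x i : Term n) (A : Fin m) : Formula n m := pairT i x ∈ₗ A

/-- `A_i = B_j`, extensionally. -/
def eqAt {n m : ℕ} (i : Term n) (A : Fin m) (j : Term n) (B : Fin m) : Formula n m :=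
  allN (memAt (.var 0) i.wk A ⟷ₗ memAt (.var 0) j.wk B)

/-- `A` is nontrivial: `∃ i ∃ x (x ∈ A_i)`. -/
def nontrivialFamily {m : ℕ} (A : Fin m) : Formula 0 m :=
  exN (exN (memAt (.var 0) (.var 1) A))

/-- `B` is a subfamily of `A`: `∀ i ∃ j (B_i = A_j)`. -/
def subfamily {m : ℕ} (B A : Fin m) : Formula 0 m :=
  allN (exN (eqAt (.var 1) B (.var 0) A))

/-- `B` has the `D̄₂` intersection property: `∀ i ∀ j (B_i ≠ B_j → ∃ x (x ∈ B_i ∧ x ∈ B_j))`. -/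
def intersectionD2 {m : ℕ} (B : Fin m) : Formula 0 m :=
  allN (allN (neg (eqAt (.var 1) B (.var 0) B) ⟶ₗ
    exN (memAt (.var 0) (.var 2) B ∧ₗ memAt (.var 0) (.var 1) B)))

/-- `B` is a maximal subfamily of `A` with the `D̄₂` intersection property: it is a subfamily
with the property, and for every subfamily `C` of `A` with the property, if `B` is a subfamily of
`C` then `C` is a subfamily of `B`. -/
def maximalSubfamilyD2 {m : ℕ} (B A : Fin m) : Formula 0 m :=
  subfamily B A ∧ₗ intersectionD2 B ∧ₗ
  allS (subfamily 0 A.succ ∧ₗ intersectionD2 0 ∧ₗ subfamily B.succ 0 ⟶ₗ subfamily 0 B.succ)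

/-- The principle `D̄₂IP`: every nontrivial family of sets has a maximal subfamily with the `D̄₂`
intersection property. -/
def D2IP : Sentence :=
  allS (nontrivialFamily 0 ⟶ₗ exS (maximalSubfamilyD2 0 1))

/-! ## Hyperimmune degrees -/

open Classical in
/-- The characteristic function of `X`, as an oracle. -/
noncomputable def charFn (X : Set ℕ) : ℕ →. ℕ := fun k => Part.some (if k ∈ X then 1 else 0)

/-- `X` has hyperimmune degree: it computes a function that is not dominated by any computable
function. -/
def HasHyperimmuneDegree (X : Set ℕ) : Prop :=
  ∃ f : ℕ → ℕ, TuringReducible (fun k => Part.some (f k)) (charFn X) ∧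
    ∀ g : ℕ → ℕ, Computable g → ¬ ∀ᶠ k in Filter.atTop, f k ≤ g k

end SOA

/-!
The proof has three parts.

**A generic sequence of sets.** `exists_isGeneric` builds a sequence `G` of subsets of `ℕ` by
forcing with nonempty `Π⁰₁` classes of sequences that constrain only finitely many columns. Below
a condition, a given `Σ⁰₁` search in finitely many columns either can be made to fail for some
input, by shrinking the class, or succeeds on the whole class, and then compactness gives a
computable bound for it (`IsCondition.exists_bounded`). Moreover, any `Π⁰₁` class relative to
finitely many columns that can be made nonempty can be given a member among the columns, namely a
column that the condition does not constrain (`IsCondition.exists_column`). The second property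
makes the columns an `ω`-model of `Δ⁰₁` comprehension and of weak König's lemma, as a `Δ⁰₁` set and
the paths of an infinite binary tree both form nonempty `Π⁰₁` classes relative to the parameters
(`IsGeneric.mem_model`, `IsGeneric.satisfies_weakKonigLemma`). The first property implies that
functions computable from a column are computably dominated
(`IsGeneric.not_hasHyperimmuneDegree`).

**A graph without tame maximal cliques.** There is a computably enumerable graph on `ℕ` for which
no enumeration of a maximal clique can live in such a model. Each vertex `v` has a level and
declares a finite set of vertices of lower level; each level is attached to a partial computable
function, and every such function is attached to infinitely many levels. A vertex `x` is linked to
a vertex `y` of at least the same level only if `x` and the vertices declared by `y` form a clique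
and either `y` declares `x`, or the function of the level of `x` has converged on an initial
segment reaching beyond `y`. In the second case the edge appears only after the function has taken
the values in question, so that it appears late if the function grows quickly.

Let `K` be a maximal clique and let `n` be a total level above that of some element of `K`. Close
`K` under passing from vertices of level at least `n` to those they declare. The vertices of level
at most `n` obtained in this way form a clique (`Reach.near`), and only finitely many of them lie
below level `n` on levels with a non-total function (`finite_reach_not_total`). So there is a
vertex of level `n` that declares exactly these, it is linked to everything in `K`, and therefore
it is in `K` (`exists_mem_level_eq`). Now suppose that the edges between the elements of `K`
enumerated up to the first one of level at least `k` all appear by stage `h k` with `h` computable.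
Then `K` has two elements `v₀` and `v` on different levels attached to `h` such that neither
declares the other. Vertices of high level enumerated early enough can be linked to `v` in time
only by declaring it, but this is propagated to an edge that would have to appear too early
(`IsMaximalClique.not_computably_bounded`).

**The family.** To the vertex `i` belongs the set consisting of a tag for `i` and of codes of the
edges at `i` together with witnesses for them. These sets are pairwise distinct, two of them meet
iff their vertices are linked, and the family is computable. So a maximal subfamily with the
intersection property in the model would enumerate a maximal clique, and the search for the stage
by which its edges have appeared would be computably bounded, a contradiction
(`IsGeneric.not_satisfies_D2IP`). Unprovability follows by soundness of the deduction system
(`Derives.sound`).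
-/


namespace SOA

/-! ### Primitive recursive predicates with bounded quantifiers -/

section PrimrecPred

variable {α β : Type} [Primcodable α] [Primcodable β]

theorem primrecPred_forall_mem {f : α → List β} {R : α → β → Prop} (hf : Primrec f)
    (hR : PrimrecPred fun q : α × β => R q.1 q.2) : PrimrecPred fun a => ∀ b ∈ f a, R a b :=
  PrimrecRel.comp (R := fun (L : List β) (a : α) => ∀ b ∈ L, R a b)
    (PrimrecRel.forall_mem_list (R := fun b a => R a b)
      (PrimrecPred.comp (f := fun q : β × α => (q.2, q.1)) hR
        (Primrec.snd.pair Primrec.fst))) hf Primrec.id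

theorem primrecPred_exists_mem {f : α → List β} {R : α → β → Prop} (hf : Primrec f)
    (hR : PrimrecPred fun q : α × β => R q.1 q.2) : PrimrecPred fun a => ∃ b ∈ f a, R a b :=
  PrimrecRel.comp (R := fun (L : List β) (a : α) => ∃ b ∈ L, R a b)
    (PrimrecRel.exists_mem_list (R := fun b a => R a b)
      (PrimrecPred.comp (f := fun q : β × α => (q.2, q.1)) hR
        (Primrec.snd.pair Primrec.fst))) hf Primrec.id

theorem primrecPred_forall_lt {f : α → ℕ} {R : α → ℕ → Prop} (hf : Primrec f)
    (hR : PrimrecPred fun q : α × ℕ => R q.1 q.2) : PrimrecPred fun a => ∀ b < f a, R a b :=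
  (primrecPred_forall_mem (Primrec.list_range.comp hf) hR).of_eq (by simp)

theorem primrecPred_exists_lt {f : α → ℕ} {R : α → ℕ → Prop} (hf : Primrec f)
    (hR : PrimrecPred fun q : α × ℕ => R q.1 q.2) : PrimrecPred fun a => ∃ b < f a, R a b :=
  (primrecPred_exists_mem (Primrec.list_range.comp hf) hR).of_eq (by simp)

theorem primrecPred_imp {p q : α → Prop} (hp : PrimrecPred p) (hq : PrimrecPred q) :
    PrimrecPred fun a => p a → q a :=
  (hp.not.or hq).of_eq fun _ => imp_iff_not_or.symm

theorem primrecPred_mem {f : α → List β} {g : α → β} (hf : Primrec f) (hg : Primrec g) :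
    PrimrecPred fun a => g a ∈ f a := by
  refine (primrecPred_exists_mem (R := fun a b => b = g a) hf ?_).of_eq (by simp)
  classical
  exact Primrec.eq.comp Primrec.snd (hg.comp Primrec.fst)

end PrimrecPred

/-! ### Effectively open predicates of an oracle -/

/-- An oracle: a sequence `G 0, G 1, …` of characteristic functions, its columns. -/
abbrev Oracle : Type := ℕ → ℕ → Bool

namespace Oracle

/-- The first `s` bits of an oracle, whose entry in column `i` and row `x` has position
`Nat.pair i x`. -/
def restr (G : Oracle) (s : ℕ) : List Bool :=
  (List.range s).map fun p => G p.unpair.1 p.unpair.2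

@[simp] theorem length_restr (G : Oracle) (s : ℕ) : (G.restr s).length = s := by simp [restr]

theorem take_restr (G : Oracle) {u s : ℕ} (h : u ≤ s) : (G.restr s).take u = G.restr u := by
  simp [restr, ← List.map_take, List.take_range, Nat.min_eq_left h]

theorem getElem?_restr (G : Oracle) (s i x : ℕ) :
    (G.restr s)[Nat.pair i x]? = if Nat.pair i x < s then some (G i x) else none := by
  split_ifs with h
  · simp [restr, List.getElem?_range h]
  · simp [restr, List.getElem?_eq_none (l := List.range s) (by simpa using h)]

/-- The oracle with an extra first column `Y`. -/
def cons (Y : ℕ → Bool) (G : Oracle) : Oracle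
  | 0 => Y
  | i + 1 => G i

/-- The set with characteristic function `G i`. -/
def col (G : Oracle) (i : ℕ) : Set ℕ := {x | G i x = true}

end Oracle

open Oracle

/-- `P G a` is a `Σ⁰₁` condition on the oracle `G` and the number-like object `a`, uniformly in
both: it is witnessed by a finite part of `G`, recognised primitive recursively. -/
def SigmaOne {α : Type} [Primcodable α] (P : Oracle → α → Prop) : Prop :=
  ∃ R : List Bool → α → Prop, PrimrecRel R ∧ ∀ G a, P G a ↔ ∃ s, R (G.restr s) a

namespace SigmaOne

variable {α β : Type} [Primcodable α] [Primcodable β] {P Q : Oracle → α → Prop}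

/-- The recognising predicate can be chosen monotone in the finite part of the oracle. -/
theorem exists_mono (hP : SigmaOne P) : ∃ R : List Bool → α → Prop, PrimrecRel R ∧
    (∀ G a, P G a ↔ ∃ s, R (G.restr s) a) ∧
    ∀ (G : Oracle) a s t, s ≤ t → R (G.restr s) a → R (G.restr t) a := by
  obtain ⟨R, hR, h⟩ := hP
  refine ⟨fun σ a => ∃ u < σ.length + 1, R (σ.take u) a, ?_, ?_, ?_⟩
  · refine primrecPred_exists_lt (f := fun q : List Bool × α => q.1.length + 1)
      (R := fun q u => R (q.1.take u) q.2)
      (Primrec.succ.comp (Primrec.list_length.comp Primrec.fst)) ?_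
    exact hR.comp (Primrec.list_take.comp Primrec.snd (Primrec.fst.comp Primrec.fst))
      (Primrec.snd.comp Primrec.fst)
  · intro G a
    rw [h]
    constructor
    · rintro ⟨s, hs⟩
      exact ⟨s, s, by simp, by rwa [take_restr _ le_rfl]⟩
    · rintro ⟨s, u, hu, hs⟩
      rw [length_restr] at hu
      rw [take_restr _ (by omega)] at hs
      exact ⟨u, hs⟩
  · rintro G a s t hst ⟨u, hu, hs⟩
    rw [length_restr] at hu
    rw [take_restr _ (by omega)] at hs
    exact ⟨u, by rw [length_restr]; omega, by rwa [take_restr _ (by omega)]⟩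

theorem of_iff (hP : SigmaOne P) (h : ∀ G a, Q G a ↔ P G a) : SigmaOne Q := by
  have : Q = P := funext₂ fun G a => propext (h G a)
  rwa [this]

theorem of_primrec {p : α → Prop} (hp : PrimrecPred p) : SigmaOne fun _ a => p a :=
  ⟨fun _ a => p a, hp.comp Primrec.snd, by simp⟩

theorem get {i x : α → ℕ} (hi : Primrec i) (hx : Primrec x) (b : Bool) :
    SigmaOne fun G a => G (i a) (x a) = b := by
  refine ⟨fun σ a => σ[Nat.pair (i a) (x a)]? = some b, ?_, ?_⟩
  · exact Primrec.eq.comp (Primrec.list_getElem?.comp Primrec.fst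
      ((Primrec₂.natPair.comp hi hx).comp Primrec.snd)) (Primrec.const _)
  · intro G a
    simp only [getElem?_restr]
    constructor
    · intro h
      exact ⟨Nat.pair (i a) (x a) + 1, by simp [h]⟩
    · rintro ⟨s, hs⟩
      split_ifs at hs
      simpa using hs

theorem comp {P : Oracle → β → Prop} (hP : SigmaOne P) {f : α → β} (hf : Primrec f) :
    SigmaOne fun G a => P G (f a) := by
  obtain ⟨R, hR, h⟩ := hP
  exact ⟨fun σ a => R σ (f a), hR.comp Primrec.fst (hf.comp Primrec.snd), fun G a => h G (f a)⟩

theorem and (hP : SigmaOne P) (hQ : SigmaOne Q) : SigmaOne fun G a => P G a ∧ Q G a := by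
  obtain ⟨R, hR, h, hm⟩ := hP.exists_mono
  obtain ⟨S, hS, k, km⟩ := hQ.exists_mono
  refine ⟨fun σ a => R σ a ∧ S σ a, PrimrecPred.and hR hS, fun G a => ?_⟩
  beta_reduce
  rw [h, k]
  constructor
  · rintro ⟨⟨s, hs⟩, t, ht⟩
    exact ⟨max s t, hm _ _ _ _ (le_max_left _ _) hs, km _ _ _ _ (le_max_right _ _) ht⟩
  · rintro ⟨s, hs, ht⟩
    exact ⟨⟨s, hs⟩, s, ht⟩

theorem or (hP : SigmaOne P) (hQ : SigmaOne Q) : SigmaOne fun G a => P G a ∨ Q G a := by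
  obtain ⟨R, hR, h⟩ := hP
  obtain ⟨S, hS, k⟩ := hQ
  refine ⟨fun σ a => R σ a ∨ S σ a, PrimrecPred.or hR hS, fun G a => ?_⟩
  beta_reduce
  rw [h, k, exists_or]

theorem imp (hP : SigmaOne fun G a => ¬ P G a) (hQ : SigmaOne Q) :
    SigmaOne fun G a => P G a → Q G a :=
  (hP.or hQ).of_iff fun _ _ => imp_iff_not_or

theorem ex {P : Oracle → α → ℕ → Prop} (hP : SigmaOne fun G (q : α × ℕ) => P G q.1 q.2) :
    SigmaOne fun G a => ∃ n, P G a n := by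
  obtain ⟨R, hR, h, hm⟩ := hP.exists_mono
  refine ⟨fun σ a => ∃ n < σ.length, R σ (a, n), ?_, fun G a => ?_⟩
  · refine primrecPred_exists_lt (f := fun q : List Bool × α => q.1.length)
      (R := fun q u => R q.1 (q.2, u)) (Primrec.list_length.comp Primrec.fst) ?_
    exact hR.comp (Primrec.fst.comp Primrec.fst)
      ((Primrec.snd.comp Primrec.fst).pair Primrec.snd)
  · constructor
    · rintro ⟨n, hn⟩
      obtain ⟨s, hs⟩ := (h G (a, n)).1 hn
      exact ⟨max s (n + 1), n, by simp, hm _ _ _ _ (le_max_left _ _) hs⟩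
    · rintro ⟨s, n, -, hs⟩
      exact ⟨n, (h G (a, n)).2 ⟨s, hs⟩⟩

theorem ball {P : Oracle → α → ℕ → Prop} (hP : SigmaOne fun G (q : α × ℕ) => P G q.1 q.2)
    {f : α → ℕ} (hf : Primrec f) : SigmaOne fun G a => ∀ n < f a, P G a n := by
  obtain ⟨R, hR, h, hm⟩ := hP.exists_mono
  refine ⟨fun σ a => ∀ n < f a, R σ (a, n), ?_, fun G a => ?_⟩
  · refine primrecPred_forall_lt (f := fun q : List Bool × α => f q.2)
      (R := fun q u => R q.1 (q.2, u)) (hf.comp Primrec.snd) ?_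
    exact hR.comp (Primrec.fst.comp Primrec.fst)
      ((Primrec.snd.comp Primrec.fst).pair Primrec.snd)
  · constructor
    · beta_reduce
      intro H
      generalize f a = N at H
      induction N with
      | zero => exact ⟨0, by simp⟩
      | succ N ih =>
        obtain ⟨s, hs⟩ := ih fun n hn => H n (by omega)
        obtain ⟨t, ht⟩ := (h G (a, N)).1 (H N (by omega))
        refine ⟨max s t, fun n hn => ?_⟩
        rcases Nat.lt_succ_iff_lt_or_eq.1 hn with hn | rfl
        · exact hm _ _ _ _ (le_max_left _ _) (hs n hn)
        · exact hm _ _ _ _ (le_max_right _ _) ht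
    · rintro ⟨s, hs⟩ n hn
      exact (h G (a, n)).2 ⟨s, hs n hn⟩

/-- Rearranging the columns of the oracle along a primitive recursive function preserves
`Σ⁰₁` conditions. -/
theorem reindex (hP : SigmaOne P) {c : ℕ → ℕ} (hc : Primrec c) :
    SigmaOne fun G a => P (fun i => G (c i)) a := by
  obtain ⟨R, hR, h⟩ := hP
  -- `pos q` is the position in `G` of the bit at position `q` of the rearranged oracle
  let pos : ℕ → ℕ := fun q => Nat.pair (c q.unpair.1) q.unpair.2
  have hpos : Primrec pos := Primrec₂.natPair.comp
    (hc.comp (Primrec.fst.comp Primrec.unpair)) (Primrec.snd.comp Primrec.unpair)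
  let tr : List Bool → ℕ → List Bool := fun σ u => (List.range u).map fun q => σ.getD (pos q) false
  have htr : Primrec₂ tr := by
    refine Primrec.list_map (Primrec.list_range.comp Primrec.snd) ?_
    exact (Primrec.list_getD false).comp (Primrec.fst.comp Primrec.fst)
      (hpos.comp Primrec.snd)
  have key : ∀ (G : Oracle) s u, (∀ q < u, pos q < s) →
      tr (G.restr s) u = Oracle.restr (fun i => G (c i)) u := by
    intro G s u hu
    simp only [tr]
    conv_rhs => rw [restr]
    refine List.map_congr_left fun q hq => ?_
    have := hu q (List.mem_range.1 hq)
    simp only [pos] at this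
    rw [List.getD_eq_getElem?_getD, getElem?_restr, if_pos this, Option.getD_some]
  refine ⟨fun σ a => ∃ u < σ.length + 1, (∀ q < u, pos q < σ.length) ∧ R (tr σ u) a, ?_, ?_⟩
  · refine primrecPred_exists_lt (f := fun q : List Bool × α => q.1.length + 1)
      (R := fun q u => (∀ r < u, pos r < q.1.length) ∧ R (tr q.1 u) q.2)
      (Primrec.succ.comp (Primrec.list_length.comp Primrec.fst)) (PrimrecPred.and ?_ ?_)
    · refine primrecPred_forall_lt (f := fun q : (List Bool × α) × ℕ => q.2)
        (R := fun q r => pos r < q.1.1.length) Primrec.snd ?_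
      exact Primrec.nat_lt.comp (hpos.comp Primrec.snd)
        (Primrec.list_length.comp (Primrec.fst.comp (Primrec.fst.comp Primrec.fst)))
    · exact hR.comp (htr.comp (Primrec.fst.comp Primrec.fst) Primrec.snd)
        (Primrec.snd.comp Primrec.fst)
  · intro G a
    beta_reduce
    rw [h]
    constructor
    · rintro ⟨u, hu⟩
      obtain ⟨s, hs⟩ : ∃ s, ∀ q < u, pos q < s := by
        refine ⟨(Finset.range u).sup pos + 1, fun q hq => ?_⟩
        exact Nat.lt_succ_of_le (Finset.le_sup (f := pos) (Finset.mem_range.2 hq))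
      have hs' : ∀ q < u, pos q < max s u := fun q hq => lt_max_of_lt_left (hs q hq)
      exact ⟨max s u, u, by simp, by simpa using fun q hq => Or.inl (hs q hq),
        by rwa [key _ _ _ hs']⟩
    · rintro ⟨s, u, -, hu, hR⟩
      rw [length_restr] at hu
      exact ⟨u, by rwa [key _ _ _ hu] at hR⟩

theorem isOpen (hP : SigmaOne P) (a : α) : IsOpen {G : Oracle | P G a} := by
  obtain ⟨R, -, h⟩ := hP
  have hloc : ∀ s, IsLocallyConstant fun G : Oracle => G.restr s := by
    intro s
    induction s with
    | zero => exact IsLocallyConstant.const (X := Oracle) []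
    | succ s ih =>
      have hb : IsLocallyConstant fun G : Oracle => G s.unpair.1 s.unpair.2 :=
        (IsLocallyConstant.iff_continuous _).2
          ((continuous_apply _).comp (continuous_apply _))
      have := ih.comp₂ hb fun l b => l ++ [b]
      refine (congrArg IsLocallyConstant (funext fun G => ?_)).mp this
      simp [restr, List.range_succ]
  have : {G : Oracle | P G a} = ⋃ s, (fun G : Oracle => G.restr s) ⁻¹' {σ | R σ a} := by
    ext G
    simp [h]
  rw [this]
  exact isOpen_iUnion fun s => hloc s _

end SigmaOne

end SOA

namespace SOA

open Oracle

/-! ### Effective compactness -/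

/-- All bit strings of a given length. -/
def bitStrings : ℕ → List (List Bool)
  | 0 => [[]]
  | n + 1 => (bitStrings n).flatMap fun σ => [σ ++ [false], σ ++ [true]]

theorem primrec_bitStrings : Primrec bitStrings := by
  have hg : Primrec₂ fun (_ : ℕ) (L : List (List Bool)) =>
      L.flatMap fun σ => [σ ++ [false], σ ++ [true]] := by
    refine Primrec.list_flatMap Primrec.snd ?_
    refine Primrec.list_cons.comp (Primrec.list_concat.comp Primrec.snd (Primrec.const false)) ?_
    exact Primrec.list_cons.comp (Primrec.list_concat.comp Primrec.snd (Primrec.const true))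
      (Primrec.const [])
  refine (Primrec.nat_rec₁ [[]] hg).of_eq fun n => ?_
  induction n with
  | zero => rfl
  | succ n ih => simp only [bitStrings, ← ih]

theorem mem_bitStrings {n : ℕ} {σ : List Bool} : σ ∈ bitStrings n ↔ σ.length = n := by
  induction n generalizing σ with
  | zero => simp [bitStrings]
  | succ n ih =>
    simp only [bitStrings, List.mem_flatMap, ih, List.mem_cons, List.not_mem_nil, or_false]
    constructor
    · rintro ⟨τ, hτ, rfl | rfl⟩ <;> simp [hτ]
    · intro h
      have hne : σ ≠ [] := by rintro rfl; simp at h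
      refine ⟨σ.dropLast, by simp [h], ?_⟩
      have := List.dropLast_append_getLast hne
      cases hb : σ.getLast hne with
      | false => left; rw [← hb, this]
      | true => right; rw [← hb, this]

theorem exists_restr_eq (σ : List Bool) : ∃ G : Oracle, G.restr σ.length = σ := by
  refine ⟨fun i x => σ.getD (Nat.pair i x) false, ?_⟩
  refine List.ext_getElem (by simp) fun n h₁ h₂ => ?_
  simp [restr, List.getD_eq_getElem?_getD, h₂]

/-- Unbounded search for a natural number satisfying a primitive recursive condition is
computable if it always succeeds. -/
theorem exists_computable_of_primrecRel {R : ℕ → ℕ → Prop} (hR : PrimrecRel R)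
    (h : ∀ k, ∃ t, R k t) : ∃ f : ℕ → ℕ, Computable f ∧ ∀ k, R k (f k) := by
  classical
  have hp : Computable₂ fun k t => decide (R k t) := hR.decide.to_comp
  refine ⟨fun k => Nat.find (h k), ?_, fun k => Nat.find_spec (h k)⟩
  refine Partrec.of_eq_tot (Partrec.rfind hp.partrec₂) fun k => ?_
  rw [Nat.mem_rfind]
  exact ⟨by simpa using Nat.find_spec (h k), fun {m} hm => by simpa using Nat.find_min (h k) hm⟩

/-- If for each `k` every oracle satisfies one of the `Σ⁰₁` conditions `U · (k, s)`, then
bounds on the `s` that have to be tried can be computed from `k`, uniformly in the oracle. -/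
theorem SigmaOne.exists_computable_bound {U : Oracle → ℕ × ℕ → Prop} (hU : SigmaOne U)
    (h : ∀ k G, ∃ s, U G (k, s)) :
    ∃ f : ℕ → ℕ, Computable f ∧ ∀ k G, ∃ s ≤ f k, U G (k, s) := by
  obtain ⟨R, hR, hUR, hm⟩ := hU.exists_mono
  -- `S k t`: the first `t` bits of any oracle suffice to see `U · (k, s)` for some `s ≤ t`; by
  -- compactness this holds for large `t`
  let S : ℕ → ℕ → Prop := fun k t => ∀ σ ∈ bitStrings t, ∃ s < t + 1, R σ (k, s)
  have hS : PrimrecRel S := by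
    refine primrecPred_forall_mem (f := fun q : ℕ × ℕ => bitStrings q.2)
      (R := fun q σ => ∃ s < q.2 + 1, R σ (q.1, s)) (primrec_bitStrings.comp Primrec.snd) ?_
    refine primrecPred_exists_lt (f := fun q : (ℕ × ℕ) × List Bool => q.1.2 + 1)
      (R := fun q s => R q.2 (q.1.1, s))
      (Primrec.succ.comp (Primrec.snd.comp Primrec.fst)) ?_
    exact hR.comp (Primrec.snd.comp Primrec.fst)
      ((Primrec.fst.comp (Primrec.fst.comp Primrec.fst)).pair Primrec.snd)
  have hex : ∀ k, ∃ t, S k t := by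
    intro k
    have hopen : ∀ t, IsOpen {G : Oracle | ∃ s < t + 1, R (G.restr t) (k, s)} := by
      intro t
      have : SigmaOne fun (G : Oracle) (_ : Unit) => ∃ s < t + 1, R (G.restr t) (k, s) := by
        refine ⟨fun σ _ => t ≤ σ.length ∧ ∃ s < t + 1, R (σ.take t) (k, s), ?_, ?_⟩
        · refine PrimrecPred.and (Primrec.nat_le.comp (Primrec.const t)
            (Primrec.list_length.comp Primrec.fst)) ?_
          refine primrecPred_exists_lt (f := fun _ : List Bool × Unit => t + 1)
            (R := fun q s => R (q.1.take t) (k, s)) (Primrec.const _) ?_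
          exact hR.comp (Primrec.list_take.comp (Primrec.const t)
            (Primrec.fst.comp Primrec.fst)) ((Primrec.const k).pair Primrec.snd)
        · intro G a
          beta_reduce
          constructor
          · intro H
            exact ⟨t, by simp, by rwa [take_restr _ le_rfl]⟩
          · rintro ⟨s, hs, H⟩
            rw [length_restr] at hs
            rwa [take_restr _ hs] at H
      exact this.isOpen ()
    obtain ⟨T, hT⟩ := isCompact_univ.elim_finite_subcover _ hopen fun G _ => by
      obtain ⟨s, hs⟩ := h k G
      obtain ⟨t, ht⟩ := (hUR G (k, s)).1 hs
      exact Set.mem_iUnion.2 ⟨max s t, s, by simp, hm _ _ _ _ (le_max_right _ _) ht⟩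
    refine ⟨T.sup id, fun σ hσ => ?_⟩
    rw [mem_bitStrings] at hσ
    obtain ⟨G, hG⟩ := exists_restr_eq σ
    rw [hσ] at hG
    have := hT (Set.mem_univ G)
    simp only [Set.mem_iUnion, Set.mem_ofPred_eq] at this
    obtain ⟨t, htT, s, hst, hs⟩ := this
    have htT : t ≤ T.sup id := Finset.le_sup (f := id) htT
    exact ⟨s, by omega, hG ▸ hm _ _ _ _ htT hs⟩
  obtain ⟨f, hf, hfS⟩ := exists_computable_of_primrecRel hS hex
  refine ⟨f, hf, fun k G => ?_⟩
  obtain ⟨s, hs, hR⟩ := hfS k (G.restr (f k)) (mem_bitStrings.2 (length_restr _ _))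
  exact ⟨s, by omega, (hUR G (k, s)).2 ⟨_, hR⟩⟩

/-! ### A generic sequence of sets -/

/-- The predicate `P` depends only on the columns below `c`. -/
def DependsBelow {α : Type} (P : Oracle → α → Prop) (c : ℕ) : Prop :=
  ∀ G G' : Oracle, (∀ i < c, G i = G' i) → ∀ a, P G a → P G' a

theorem countable_primrecPred (α : Type) [Primcodable α] :
    {p : α → Prop | PrimrecPred p}.Countable := by
  refine (Set.countable_range fun (c : Nat.Partrec.Code) (a : α) =>
    1 ∈ c.eval (Encodable.encode a)).mono ?_
  rintro p ⟨_, hp⟩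
  obtain ⟨c, hc⟩ := Nat.Partrec.Code.exists_code.1 hp.to_comp
  refine ⟨c, funext fun a => propext ?_⟩
  simp [hc, Encodable.encodek]
  by_cases h : p a <;> simp [h]

theorem countable_sigmaOne (α : Type) [Primcodable α] :
    {P : Oracle → α → Prop | SigmaOne P}.Countable := by
  refine ((countable_primrecPred (List Bool × α)).image
    fun p (G : Oracle) a => ∃ s, p (G.restr s, a)).mono ?_
  rintro P ⟨R, hR, h⟩
  exact ⟨fun q => R q.1 q.2, hR, funext₂ fun G a => propext (h G a).symm⟩

/-- A nonempty `Π⁰₁` class of oracles that constrains only finitely many columns. -/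
def IsCondition (C : Set Oracle) : Prop :=
  C.Nonempty ∧ ∃ (U : Oracle → Unit → Prop) (c : ℕ),
    SigmaOne U ∧ DependsBelow U c ∧ C = {G | ¬ U G ()}

/-- Below any condition, either a given `Σ⁰₁` search fails, or it is computably bounded. -/
theorem IsCondition.exists_bounded {C : Set Oracle} (hC : IsCondition C)
    {P : Oracle → ℕ × ℕ → Prop} (hP : SigmaOne P) {c : ℕ} (hPc : DependsBelow P c) :
    ∃ D ⊆ C, IsCondition D ∧ ∀ G ∈ D, (∀ k, ∃ s, P G (k, s)) →
      ∃ f : ℕ → ℕ, Computable f ∧ ∀ k, ∃ s ≤ f k, P G (k, s) := by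
  have hC' := hC
  obtain ⟨hne, U, d, hU, hUd, rfl⟩ := hC
  by_cases H : ∃ k, ∃ G, ¬ U G () ∧ ∀ s, ¬ P G (k, s)
  · -- the search for `k` can be made to fail
    obtain ⟨k, G, hG, hGk⟩ := H
    refine ⟨{G | ¬ (U G () ∨ ∃ s, P G (k, s))}, fun G hG h => hG (Or.inl h),
      ⟨⟨G, by simpa using ⟨hG, hGk⟩⟩, _, max c d, hU.or (SigmaOne.ex
        (P := fun G (_ : Unit) s => P G (k, s))
        (hP.comp ((Primrec.const k).pair Primrec.snd))), ?_, rfl⟩, ?_⟩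
    · rintro G G' hGG a (h | ⟨s, hs⟩)
      · exact Or.inl (hUd _ _ (fun i hi => hGG i (lt_max_of_lt_right hi)) _ h)
      · exact Or.inr ⟨s, hPc _ _ (fun i hi => hGG i (lt_max_of_lt_left hi)) _ hs⟩
    · intro G hG hk
      exact absurd (Or.inr (hk k)) hG
  · push Not at H
    refine ⟨_, subset_rfl, hC', fun G hG _ => ?_⟩
    -- every oracle either leaves the class or makes the search succeed
    obtain ⟨f, hf, hfb⟩ := SigmaOne.exists_computable_bound
      (U := fun G q => U G () ∨ P G q) ((hU.comp (Primrec.const ())).or hP) (by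
        intro k G
        by_cases hG : U G ()
        · exact ⟨0, Or.inl hG⟩
        · obtain ⟨s, hs⟩ := H k G hG
          exact ⟨s, Or.inr hs⟩)
    refine ⟨f, hf, fun k => ?_⟩
    obtain ⟨s, hs, h | h⟩ := hfb k G
    · exact absurd h hG
    · exact ⟨s, hs, h⟩

theorem primrec_ite_zero (j : ℕ) : Primrec fun i => if i = 0 then j else i - 1 :=
  Primrec.ite (Primrec.eq.comp Primrec.id (Primrec.const 0)) (Primrec.const j) Primrec.pred

theorem cons_self_eq (G : Oracle) (j : ℕ) :
    cons (G j) G = fun i => G (if i = 0 then j else i - 1) := by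
  funext i
  cases i <;> rfl

/-- Below any condition, either a given `Π⁰₁` class relative to the oracle is empty, or it has a
member among the columns: a column that is not yet constrained can be put into it. -/
theorem IsCondition.exists_column {C : Set Oracle} (hC : IsCondition C)
    {P : Oracle → Unit → Prop} (hP : SigmaOne P) {c : ℕ} (hPc : DependsBelow P c) :
    ∃ D ⊆ C, IsCondition D ∧ ∀ G ∈ D, (∃ Y, ¬ P (cons Y G) ()) → ∃ j, ¬ P (cons (G j) G) () := by
  have hC' := hC
  obtain ⟨hne, U, d, hU, hUd, rfl⟩ := hC
  by_cases H : ∃ G Y, ¬ U G () ∧ ¬ P (cons Y G) ()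
  · obtain ⟨G, Y, hG, hY⟩ := H
    let j := max c d
    let G' : Oracle := Function.update G j Y
    have hGG : ∀ i < j, G' i = G i := fun i hi => Function.update_of_ne hi.ne _ _
    have hj : SigmaOne fun G a => P (cons (G j) G) a := by
      simp only [cons_self_eq]
      exact hP.reindex (primrec_ite_zero j)
    refine ⟨{G | ¬ (U G () ∨ P (cons (G j) G) ())}, fun G hG h => hG (Or.inl h),
      ⟨⟨G', ?_⟩, _, j + 1, hU.or hj, ?_, rfl⟩, ?_⟩
    · rintro (h | h)
      · exact hG (hUd _ _ (fun i hi => hGG i (lt_max_of_lt_right hi)) _ h)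
      · refine hY (hPc _ _ ?_ _ h)
        rintro (_ | i) hi
        · simp [cons, G']
        · exact hGG i (lt_max_of_lt_left (by omega))
    · rintro G G' hGG a (h | h)
      · exact Or.inl (hUd _ _ (fun i hi => hGG i
          (Nat.lt_succ_of_lt (lt_max_of_lt_right hi))) _ h)
      · refine Or.inr (hPc _ _ ?_ _ h)
        rintro (_ | i) hi
        · exact hGG j (by omega)
        · exact hGG i (Nat.lt_succ_of_lt (lt_max_of_lt_left (by omega)))
    · intro G hG _
      exact ⟨j, fun h => hG (Or.inr h)⟩
  · push Not at H
    refine ⟨_, subset_rfl, hC', fun G hG ⟨Y, hY⟩ => absurd (H G Y hG) hY⟩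

/-- A generic oracle: every `Σ⁰₁` search in finitely many columns that always succeeds is
computably bounded, and every nonempty `Π⁰₁` class relative to finitely many columns has a
member among the columns. -/
structure IsGeneric (G : Oracle) : Prop where
  bounded : ∀ (P : Oracle → ℕ × ℕ → Prop) (c : ℕ), SigmaOne P → DependsBelow P c →
    (∀ k, ∃ s, P G (k, s)) → ∃ f : ℕ → ℕ, Computable f ∧ ∀ k, ∃ s ≤ f k, P G (k, s)
  column : ∀ (P : Oracle → Unit → Prop) (c : ℕ), SigmaOne P → DependsBelow P c →
    (∃ Y, ¬ P (cons Y G) ()) → ∃ j, ¬ P (cons (G j) G) ()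

theorem IsCondition.isClosed {C : Set Oracle} (hC : IsCondition C) : IsClosed C := by
  obtain ⟨-, U, d, hU, -, rfl⟩ := hC
  exact (hU.isOpen ()).isClosed_compl

/-- The meeting of countably many requirements along a decreasing sequence of conditions. -/
theorem exists_isGeneric : ∃ G, IsGeneric G := by
  let Req := {P : Oracle → ℕ × ℕ → Prop // SigmaOne P} ×
    {P : Oracle → Unit → Prop // SigmaOne P}
  have : Countable Req := by
    have := (countable_sigmaOne (ℕ × ℕ)).to_subtype
    have := (countable_sigmaOne Unit).to_subtype
    exact inferInstanceAs (Countable ({P : Oracle → ℕ × ℕ → Prop | SigmaOne P} ×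
      {P : Oracle → Unit → Prop | SigmaOne P} : Type _))
  have h0 : ∀ {α : Type} [Primcodable α], SigmaOne fun (_ : Oracle) (_ : α) => False :=
    fun {α} _ => SigmaOne.of_primrec ⟨fun _ => instDecidableFalse, by simpa using Primrec.const _⟩
  have : Nonempty Req := ⟨⟨_, h0⟩, ⟨_, h0⟩⟩
  obtain ⟨req, hreq⟩ := exists_surjective_nat Req
  let Meets : Oracle → Req → Prop := fun G r =>
    (∀ c, DependsBelow r.1.1 c → (∀ k, ∃ s, r.1.1 G (k, s)) →
      ∃ f : ℕ → ℕ, Computable f ∧ ∀ k, ∃ s ≤ f k, r.1.1 G (k, s)) ∧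
    ∀ c, DependsBelow r.2.1 c → (∃ Y, ¬ r.2.1 (cons Y G) ()) → ∃ j, ¬ r.2.1 (cons (G j) G) ()
  have step : ∀ (r : Req) (C : {C // IsCondition C}),
      ∃ D : {C // IsCondition C}, D.1 ⊆ C.1 ∧ ∀ G ∈ D.1, Meets G r := by
    rintro ⟨⟨P, hP⟩, ⟨Q, hQ⟩⟩ ⟨C, hC⟩
    obtain ⟨D, hDC, hD, hDP⟩ : ∃ D ⊆ C, IsCondition D ∧ ∀ G ∈ D, ∀ c, DependsBelow P c →
        (∀ k, ∃ s, P G (k, s)) →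
        ∃ f : ℕ → ℕ, Computable f ∧ ∀ k, ∃ s ≤ f k, P G (k, s) := by
      by_cases h : ∃ c, DependsBelow P c
      · obtain ⟨c, hc⟩ := h
        obtain ⟨D, h₁, h₂, h₃⟩ := hC.exists_bounded hP hc
        exact ⟨D, h₁, h₂, fun G hG _ _ => h₃ G hG⟩
      · exact ⟨C, subset_rfl, hC, fun G _ c hc => absurd ⟨c, hc⟩ h⟩
    obtain ⟨E, hED, hE, hEQ⟩ : ∃ E ⊆ D, IsCondition E ∧ ∀ G ∈ E, ∀ c, DependsBelow Q c →
        (∃ Y, ¬ Q (cons Y G) ()) → ∃ j, ¬ Q (cons (G j) G) () := by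
      by_cases h : ∃ c, DependsBelow Q c
      · obtain ⟨c, hc⟩ := h
        obtain ⟨E, h₁, h₂, h₃⟩ := hD.exists_column hQ hc
        exact ⟨E, h₁, h₂, fun G hG _ _ => h₃ G hG⟩
      · exact ⟨D, subset_rfl, hD, fun G _ c hc => absurd ⟨c, hc⟩ h⟩
    exact ⟨⟨E, hE⟩, hED.trans hDC, fun G hG => ⟨hDP G (hED hG), hEQ G hG⟩⟩
  choose next hsub hmeet using step
  have htop : IsCondition Set.univ :=
    ⟨⟨fun _ _ => false, trivial⟩, fun _ _ => False, 0, h0, fun _ _ _ _ h => h, by simp⟩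
  let seq : ℕ → {C // IsCondition C} :=
    fun n => Nat.rec ⟨Set.univ, htop⟩ (fun n C => next (req n) C) n
  obtain ⟨G, hG⟩ := IsCompact.nonempty_iInter_of_sequence_nonempty_isCompact_isClosed
    (fun n => (seq n).1) (fun n => hsub _ _) (fun n => (seq n).2.1) isCompact_univ
    fun n => (seq n).2.isClosed
  rw [Set.mem_iInter] at hG
  refine ⟨G, fun P c hP hc => ?_, fun P c hP hc => ?_⟩
  · obtain ⟨n, hn⟩ := hreq (⟨P, hP⟩, ⟨_, h0⟩)
    have := (hmeet (req n) (seq n) G (hG (n + 1))).1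
    rw [hn] at this
    exact this c hc
  · obtain ⟨n, hn⟩ := hreq (⟨_, h0⟩, ⟨P, hP⟩)
    have := (hmeet (req n) (seq n) G (hG (n + 1))).2
    rw [hn] at this
    exact this c hc

end SOA

namespace SOA

open Oracle

/-! ### Functions computable from a set have `Σ⁰₁` graphs -/

/-- A value of a function defined by recursion is described by the list of all values up to it. -/
theorem mem_nat_rec_part {f₀ : Part ℕ} {h : ℕ → ℕ → Part ℕ} (n m : ℕ) :
    m ∈ (n.rec f₀ fun y IH => IH.bind (h y) : Part ℕ) ↔
      ∃ l : List ℕ, l.getD 0 0 ∈ f₀ ∧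
        (∀ y < n, l.getD (y + 1) 0 ∈ h y (l.getD y 0)) ∧ l.getD n 0 = m := by
  constructor
  · intro H
    -- the list of all intermediate values
    suffices ∃ l : List ℕ, l.length = n + 1 ∧ l.getD 0 0 ∈ f₀ ∧
        (∀ y < n, l.getD (y + 1) 0 ∈ h y (l.getD y 0)) ∧ l.getD n 0 = m by
      obtain ⟨l, -, hl⟩ := this
      exact ⟨l, hl⟩
    induction n generalizing m with
    | zero => exact ⟨[m], rfl, by simpa using H, by simp, rfl⟩
    | succ n ih =>
      obtain ⟨k, hk, hm⟩ := Part.mem_bind_iff.1 H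
      obtain ⟨l, hl, h₁, h₂, h₃⟩ := ih k hk
      have happ : ∀ y ≤ n, (l ++ [m]).getD y 0 = l.getD y 0 := fun y hy =>
        List.getD_append _ _ _ _ (by omega)
      have hlast : (l ++ [m]).getD (n + 1) 0 = m := by
        rw [List.getD_append_right _ _ _ _ (by omega)]
        simp [hl]
      refine ⟨l ++ [m], by simp [hl], by rwa [happ 0 (by omega)], fun y hy => ?_, hlast⟩
      rcases Nat.lt_succ_iff_lt_or_eq.1 hy with hy | rfl
      · rw [happ _ (by omega), happ _ (by omega)]
        exact h₂ y hy
      · rw [hlast, happ _ le_rfl, h₃]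
        exact hm
  · rintro ⟨l, h₁, h₂, rfl⟩
    induction n with
    | zero => exact h₁
    | succ n ih =>
      exact Part.mem_bind_iff.2 ⟨_, ih fun y hy => h₂ y (by omega), h₂ n (by omega)⟩

/-- The graph of a function partial computable from `X` is defined by a `Σ⁰₁` condition on the
oracles that have `X` as their first column. -/
theorem exists_sigmaOne_graph {X : Set ℕ} {f : ℕ →. ℕ} (hf : Nat.RecursiveIn {charFn X} f) :
    ∃ P : Oracle → ℕ × ℕ → Prop, SigmaOne P ∧
      ∀ H : Oracle, H.col 0 = X → ∀ n m, m ∈ f n ↔ P H (n, m) := by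
  have hu₁ : Primrec fun n : ℕ => n.unpair.1 := Primrec.fst.comp Primrec.unpair
  have hu₂ : Primrec fun n : ℕ => n.unpair.2 := Primrec.snd.comp Primrec.unpair
  induction hf with
  | zero =>
    exact ⟨fun _ q => q.2 = 0, .of_primrec (Primrec.eq.comp Primrec.snd (Primrec.const 0)),
      fun H _ n m => Part.mem_some_iff⟩
  | succ =>
    exact ⟨fun _ q => q.2 = q.1 + 1,
      .of_primrec (Primrec.eq.comp Primrec.snd (Primrec.succ.comp Primrec.fst)),
      fun H _ n m => Part.mem_some_iff⟩
  | left =>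
    exact ⟨fun _ q => q.2 = q.1.unpair.1,
      .of_primrec (Primrec.eq.comp Primrec.snd (hu₁.comp Primrec.fst)),
      fun H _ n m => Part.mem_some_iff⟩
  | right =>
    exact ⟨fun _ q => q.2 = q.1.unpair.2,
      .of_primrec (Primrec.eq.comp Primrec.snd (hu₂.comp Primrec.fst)),
      fun H _ n m => Part.mem_some_iff⟩
  | oracle g hg =>
    rw [Set.mem_singleton_iff.1 hg]
    refine ⟨fun H q => (H 0 q.1 = true ∧ q.2 = 1) ∨ (H 0 q.1 = false ∧ q.2 = 0),
      .or (.and (.get (Primrec.const 0) Primrec.fst _)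
          (.of_primrec (Primrec.eq.comp Primrec.snd (Primrec.const _))))
        (.and (.get (Primrec.const 0) Primrec.fst _)
          (.of_primrec (Primrec.eq.comp Primrec.snd (Primrec.const _)))), ?_⟩
    rintro H rfl n m
    cases h : H 0 n <;> simp [charFn, col, h]
  | pair _ _ ih₁ ih₂ =>
    obtain ⟨P, hP, hPf⟩ := ih₁
    obtain ⟨Q, hQ, hQf⟩ := ih₂
    refine ⟨fun H q => P H (q.1, q.2.unpair.1) ∧ Q H (q.1, q.2.unpair.2),
      .and (hP.comp (Primrec.fst.pair (hu₁.comp Primrec.snd)))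
        (hQ.comp (Primrec.fst.pair (hu₂.comp Primrec.snd))), ?_⟩
    intro H hH n m
    simp only [← hPf H hH, ← hQf H hH]
    simp only [Seq.seq, Part.bind_map, Part.mem_bind_iff, Part.mem_map_iff, Functor.map]
    constructor
    · rintro ⟨a, ha, b, hb, rfl⟩
      simpa using ⟨ha, hb⟩
    · rintro ⟨ha, hb⟩
      exact ⟨_, ha, _, hb, by simp⟩
  | comp _ _ ih₁ ih₂ =>
    obtain ⟨P, hP, hPf⟩ := ih₁
    obtain ⟨Q, hQ, hQf⟩ := ih₂
    refine ⟨fun H q => ∃ k, Q H (q.1, k) ∧ P H (k, q.2), SigmaOne.ex (.and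
      (hQ.comp ((Primrec.fst.comp Primrec.fst).pair Primrec.snd))
      (hP.comp (Primrec.snd.pair (Primrec.snd.comp Primrec.fst)))), ?_⟩
    intro H hH n m
    simp only [← hPf H hH, ← hQf H hH]
    exact Part.mem_bind_iff
  | prec _ _ ih₁ ih₂ =>
    obtain ⟨P, hP, hPf⟩ := ih₁
    obtain ⟨Q, hQ, hQf⟩ := ih₂
    have hL : Primrec₂ fun l y => (Denumerable.ofNat (List ℕ) l).getD y 0 :=
      (Primrec.list_getD 0).comp ((Primrec.ofNat _).comp Primrec.fst) Primrec.snd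
    refine ⟨fun H q => ∃ l, P H (q.1.unpair.1, (Denumerable.ofNat (List ℕ) l).getD 0 0) ∧
      (∀ y < q.1.unpair.2, Q H (Nat.pair q.1.unpair.1 (Nat.pair y
        ((Denumerable.ofNat (List ℕ) l).getD y 0)),
        (Denumerable.ofNat (List ℕ) l).getD (y + 1) 0)) ∧
      (Denumerable.ofNat (List ℕ) l).getD q.1.unpair.2 0 = q.2, SigmaOne.ex (.and ?_ (.and ?_ ?_)),
      ?_⟩
    · exact hP.comp ((hu₁.comp (Primrec.fst.comp Primrec.fst)).pair
        (hL.comp Primrec.snd (Primrec.const 0)))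
    · refine SigmaOne.ball (P := fun H (q : (ℕ × ℕ) × ℕ) y => Q H (Nat.pair q.1.1.unpair.1
        (Nat.pair y ((Denumerable.ofNat (List ℕ) q.2).getD y 0)),
        (Denumerable.ofNat (List ℕ) q.2).getD (y + 1) 0)) (hQ.comp (.pair ?_ ?_))
        (hu₂.comp (Primrec.fst.comp Primrec.fst))
      · exact Primrec₂.natPair.comp
          (hu₁.comp (Primrec.fst.comp (Primrec.fst.comp Primrec.fst)))
          (Primrec₂.natPair.comp Primrec.snd
            (hL.comp (Primrec.snd.comp Primrec.fst) Primrec.snd))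
      · exact hL.comp (Primrec.snd.comp Primrec.fst) (Primrec.succ.comp Primrec.snd)
    · exact .of_primrec (Primrec.eq.comp (hL.comp Primrec.snd
        (hu₂.comp (Primrec.fst.comp Primrec.fst))) (Primrec.snd.comp Primrec.fst))
    · intro H hH n m
      simp only [← hPf H hH, ← hQf H hH]
      refine (mem_nat_rec_part (h := fun y i => _) _ _).trans ?_
      constructor
      · rintro ⟨l, hl⟩
        exact ⟨Encodable.encode l, by simpa using hl⟩
      · rintro ⟨l, hl⟩
        exact ⟨_, hl⟩
  | rfind _ ih =>
    obtain ⟨P, hP, hPf⟩ := ih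
    refine ⟨fun H q => P H (Nat.pair q.1 q.2, 0) ∧
      ∀ k < q.2, ∃ v, P H (Nat.pair q.1 k, v) ∧ v ≠ 0, .and
        (hP.comp ((Primrec₂.natPair.comp Primrec.fst Primrec.snd).pair (Primrec.const 0)))
        (SigmaOne.ball (P := fun H (q : ℕ × ℕ) k => ∃ v, P H (Nat.pair q.1 k, v) ∧ v ≠ 0)
          (SigmaOne.ex (.and (hP.comp (.pair ?_ Primrec.snd)) (.of_primrec
            (Primrec.eq.comp Primrec.snd (Primrec.const 0)).not))) Primrec.snd), ?_⟩
    · exact Primrec₂.natPair.comp (Primrec.fst.comp (Primrec.fst.comp Primrec.fst))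
        (Primrec.snd.comp Primrec.fst)
    · intro H hH n m
      simp only [← hPf H hH]
      refine Nat.mem_rfind.trans ?_
      simp

/-- The sets coded by the columns of an oracle. -/
def Oracle.model (G : Oracle) : Set (Set ℕ) := Set.range G.col

theorem dependsBelow_const {α : Type} (P : Oracle → α → Prop) (i : ℕ) :
    DependsBelow (fun G => P fun _ => G i) (i + 1) := by
  intro G G' h a
  simp only [h i (Nat.lt_succ_self i), imp_self]

/-- A `Σ⁰₁` search in a single column of a generic oracle is computably bounded. -/
theorem IsGeneric.bounded_column {G : Oracle} (hG : IsGeneric G) (i : ℕ)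
    {P : Oracle → ℕ × ℕ → Prop} (hP : SigmaOne P)
    (h : ∀ k, ∃ s, P (fun _ => G i) (k, s)) :
    ∃ f : ℕ → ℕ, Computable f ∧ ∀ k, ∃ s ≤ f k, P (fun _ => G i) (k, s) :=
  hG.bounded _ _ (hP.reindex (Primrec.const i)) (dependsBelow_const P i) h

theorem IsGeneric.not_hasHyperimmuneDegree {G : Oracle} (hG : IsGeneric G) :
    ∀ X ∈ G.model, ¬ HasHyperimmuneDegree X := by
  rintro _ ⟨i, rfl⟩ ⟨f, hf, hdom⟩
  obtain ⟨P, hP, hPf⟩ := exists_sigmaOne_graph (RecursiveIn.iff_nat.1 hf)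
  have key : ∀ k m, P (fun _ => G i) (k, m) ↔ m = f k := fun k m => by
    rw [← hPf _ rfl, Part.mem_some_iff]
  obtain ⟨g, hg, hfg⟩ := hG.bounded_column i hP fun k => ⟨f k, (key _ _).2 rfl⟩
  refine hdom g hg (Filter.Eventually.of_forall fun k => ?_)
  obtain ⟨s, hs, h⟩ := hfg k
  rwa [(key _ _).1 h] at hs

end SOA

namespace SOA

open Formula

/-! ### Semantics of the syntactic operations -/

theorem Term.eval_subst {n k : ℕ} (t : Term n) (s : Fin n → Term k) (v : Fin k → ℕ) :
    (t.subst s).eval v = t.eval fun i => (s i).eval v := by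
  induction t with
  | var i => rfl
  | zero => rfl
  | one => rfl
  | add t u iht ihu => simp [Term.subst, Term.eval, iht, ihu]
  | mul t u iht ihu => simp [Term.subst, Term.eval, iht, ihu]

@[simp] theorem Term.eval_wk {n : ℕ} (t : Term n) (a : ℕ) (v : Fin n → ℕ) :
    t.wk.eval (Fin.cons a v) = t.eval v := by
  simp [Term.wk, Term.eval_subst, Term.eval]

@[simp] theorem Term.eval_var {n : ℕ} (i : Fin n) (v : Fin n → ℕ) :
    (Term.var i).eval v = v i := rfl

@[simp] theorem Term.eval_zero {n : ℕ} (v : Fin n → ℕ) : (0 : Term n).eval v = 0 := rfl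

@[simp] theorem Term.eval_one {n : ℕ} (v : Fin n → ℕ) : (1 : Term n).eval v = 1 := rfl

@[simp] theorem Term.eval_add {n : ℕ} (t u : Term n) (v : Fin n → ℕ) :
    (t + u).eval v = t.eval v + u.eval v := rfl

@[simp] theorem Term.eval_mul {n : ℕ} (t u : Term n) (v : Fin n → ℕ) :
    (t * u).eval v = t.eval v * u.eval v := rfl

namespace Formula

variable {M : Set (Set ℕ)} {n m : ℕ}

theorem realize_subst (φ : Formula n m) {k l : ℕ} (s : Fin n → Term k) (r : Fin m → Fin l)
    (v : Fin k → ℕ) (V : Fin l → Set ℕ) :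
    (φ.subst s r).Realize M v V ↔ φ.Realize M (fun i => (s i).eval v) fun j => V (r j) := by
  induction φ generalizing k l with
  | falsum => exact Iff.rfl
  | eq t u => simp [subst, Realize, Term.eval_subst]
  | lt t u => simp [subst, Realize, Term.eval_subst]
  | mem t X => simp [subst, Realize, Term.eval_subst]
  | imp φ ψ ihφ ihψ => simp [subst, Realize, ihφ, ihψ]
  | allN φ ih =>
    simp only [subst, Realize, ih]
    refine forall_congr' fun a => ?_
    congr! 1
    funext i
    refine Fin.cases ?_ (fun i => ?_) i <;> simp
  | allS φ ih =>
    simp only [subst, Realize, ih]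
    refine forall₂_congr fun X _ => ?_
    congr! 1
    funext i
    refine Fin.cases ?_ (fun i => ?_) i <;> simp

@[simp] theorem realize_eq (t u : Term n) (v : Fin n → ℕ) (V : Fin m → Set ℕ) :
    (t =ₗ u).Realize M v V ↔ t.eval v = u.eval v := Iff.rfl

@[simp] theorem realize_lt (t u : Term n) (v : Fin n → ℕ) (V : Fin m → Set ℕ) :
    (t <ₗ u).Realize M v V ↔ t.eval v < u.eval v := Iff.rfl

@[simp] theorem realize_mem (t : Term n) (X : Fin m) (v : Fin n → ℕ) (V : Fin m → Set ℕ) :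
    (t ∈ₗ X).Realize M v V ↔ t.eval v ∈ V X := Iff.rfl

@[simp] theorem realize_imp (φ ψ : Formula n m) (v : Fin n → ℕ) (V : Fin m → Set ℕ) :
    (φ ⟶ₗ ψ).Realize M v V ↔ (φ.Realize M v V → ψ.Realize M v V) := Iff.rfl

@[simp] theorem realize_allN (φ : Formula (n + 1) m) (v : Fin n → ℕ) (V : Fin m → Set ℕ) :
    (allN φ).Realize M v V ↔ ∀ a, φ.Realize M (Fin.cons a v) V := Iff.rfl

@[simp] theorem realize_allS (φ : Formula n (m + 1)) (v : Fin n → ℕ) (V : Fin m → Set ℕ) :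
    (allS φ).Realize M v V ↔ ∀ X ∈ M, φ.Realize M v (Fin.cons X V) := Iff.rfl

@[simp] theorem realize_neg (φ : Formula n m) (v : Fin n → ℕ) (V : Fin m → Set ℕ) :
    (neg φ).Realize M v V ↔ ¬ φ.Realize M v V := Iff.rfl

@[simp] theorem realize_and (φ ψ : Formula n m) (v : Fin n → ℕ) (V : Fin m → Set ℕ) :
    (φ ∧ₗ ψ).Realize M v V ↔ φ.Realize M v V ∧ ψ.Realize M v V := by
  simp [Formula.and]

@[simp] theorem realize_or (φ ψ : Formula n m) (v : Fin n → ℕ) (V : Fin m → Set ℕ) :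
    (φ ∨ₗ ψ).Realize M v V ↔ φ.Realize M v V ∨ ψ.Realize M v V := by
  simp only [Formula.or, realize_imp, realize_neg]
  tauto

@[simp] theorem realize_iff (φ ψ : Formula n m) (v : Fin n → ℕ) (V : Fin m → Set ℕ) :
    (φ ⟷ₗ ψ).Realize M v V ↔ (φ.Realize M v V ↔ ψ.Realize M v V) := by
  simp only [Formula.iff, realize_and, realize_imp]
  tauto

@[simp] theorem realize_exN (φ : Formula (n + 1) m) (v : Fin n → ℕ) (V : Fin m → Set ℕ) :
    (exN φ).Realize M v V ↔ ∃ a, φ.Realize M (Fin.cons a v) V := by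
  simp [exN]

@[simp] theorem realize_exS (φ : Formula n (m + 1)) (v : Fin n → ℕ) (V : Fin m → Set ℕ) :
    (exS φ).Realize M v V ↔ ∃ X ∈ M, φ.Realize M v (Fin.cons X V) := by
  simp [exS]

@[simp] theorem realize_wkN (φ : Formula n m) (a : ℕ) (v : Fin n → ℕ) (V : Fin m → Set ℕ) :
    φ.wkN.Realize M (Fin.cons a v) V ↔ φ.Realize M v V := by
  simp [wkN, realize_subst]

@[simp] theorem realize_wkS (φ : Formula n m) (X : Set ℕ) (v : Fin n → ℕ) (V : Fin m → Set ℕ) :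
    φ.wkS.Realize M v (Fin.cons X V) ↔ φ.Realize M v V := by
  simp [wkS, realize_subst]

@[simp] theorem realize_instN (φ : Formula (n + 1) m) (t : Term n) (v : Fin n → ℕ)
    (V : Fin m → Set ℕ) : (φ.instN t).Realize M v V ↔ φ.Realize M (Fin.cons (t.eval v) v) V := by
  rw [instN, realize_subst]
  congr! 1
  funext i
  refine Fin.cases ?_ (fun i => ?_) i <;> simp

@[simp] theorem realize_instS (φ : Formula n (m + 1)) (X : Fin m) (v : Fin n → ℕ)
    (V : Fin m → Set ℕ) : (φ.instS X).Realize M v V ↔ φ.Realize M v (Fin.cons (V X) V) := by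
  rw [instS, realize_subst]
  congr! 1
  funext i
  refine Fin.cases ?_ (fun i => ?_) i <;> simp

@[simp] theorem realize_instSucc (φ : Formula (n + 1) m) (a : ℕ) (v : Fin n → ℕ)
    (V : Fin m → Set ℕ) :
    φ.instSucc.Realize M (Fin.cons a v) V ↔ φ.Realize M (Fin.cons (a + 1) v) V := by
  rw [instSucc, realize_subst]
  congr! 1
  funext i
  refine Fin.cases ?_ (fun i => ?_) i <;> simp

@[simp] theorem realize_ofSentence (φ : Sentence) (v : Fin n → ℕ) (V : Fin m → Set ℕ) :
    (ofSentence φ : Formula n m).Realize M v V ↔ Satisfies M φ := by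
  rw [ofSentence, realize_subst, Satisfies]
  congr! 1

theorem realize_closeN : ∀ {n : ℕ} (φ : Formula n m) (V : Fin m → Set ℕ),
    φ.closeN.Realize M Fin.elim0 V ↔ ∀ v, φ.Realize M v V
  | 0, φ, V => by
    simp only [closeN]
    exact ⟨fun h v => Subsingleton.elim Fin.elim0 v ▸ h, fun h => h _⟩
  | n + 1, φ, V => by
    simp only [closeN, realize_closeN, realize_allN]
    exact ⟨fun h v => by simpa using h (Fin.tail v) (v 0), fun h v a => h _⟩

theorem satisfies_closeS : ∀ {m : ℕ} (φ : Formula 0 m),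
    Satisfies M φ.closeS ↔ ∀ V : Fin m → Set ℕ, (∀ j, V j ∈ M) → φ.Realize M Fin.elim0 V
  | 0, φ => by
    simp only [closeS]
    exact ⟨fun h V _ => Subsingleton.elim Fin.elim0 V ▸ h, fun h => h _ fun j => j.elim0⟩
  | m + 1, φ => by
    simp only [closeS, satisfies_closeS, realize_allS]
    constructor
    · intro h V hV
      simpa using h (Fin.tail V) (fun j => hV j.succ) (V 0) (hV 0)
    · intro h V hV X hX
      exact h _ (Fin.cases hX hV)

theorem satisfies_univClosure (φ : Formula n m) : Satisfies M φ.univClosure ↔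
    ∀ (v : Fin n → ℕ) (V : Fin m → Set ℕ), (∀ j, V j ∈ M) → φ.Realize M v V := by
  rw [univClosure, satisfies_closeS]
  simp only [realize_closeN]
  exact ⟨fun h v V hV => h V hV v, fun h V hV v => h v V hV⟩

end Formula

/-- Soundness of natural deduction for `ω`-models. -/
theorem Derives.sound {T : Theory} {M : Set (Set ℕ)} (hM : IsOmegaModel M T) {n m : ℕ}
    {Γ : List (Formula n m)} {φ : Formula n m} (h : Derives T Γ φ) :
    ∀ (v : Fin n → ℕ) (V : Fin m → Set ℕ), (∀ j, V j ∈ M) →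
      (∀ ψ ∈ Γ, ψ.Realize M v V) → φ.Realize M v V := by
  induction h with
  | ax h => exact fun v V _ _ => (realize_ofSentence _ v V).2 (hM _ h)
  | hyp h => exact fun v V _ hΓ => hΓ _ h
  | impI _ ih =>
    intro v V hV hΓ h
    exact ih v V hV (List.forall_mem_cons.2 ⟨h, hΓ⟩)
  | impE _ _ ih₁ ih₂ => exact fun v V hV hΓ => ih₁ v V hV hΓ (ih₂ v V hV hΓ)
  | byContra _ ih =>
    intro v V hV hΓ
    by_contra h
    exact ih v V hV (List.forall_mem_cons.2 ⟨h, hΓ⟩)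
  | allNI _ ih =>
    intro v V hV hΓ a
    exact ih _ V hV (by simpa using hΓ)
  | allNE t _ ih => exact fun v V hV hΓ => (realize_instN _ t v V).2 (ih v V hV hΓ _)
  | allSI _ ih =>
    intro v V hV hΓ X hX
    exact ih v _ (Fin.cases hX hV) (by simpa using hΓ)
  | allSE X _ ih => exact fun v V hV hΓ => (realize_instS _ X v V).2 (ih v V hV hΓ _ (hV X))
  | eqRefl t => exact fun v V _ _ => rfl
  | eqSubst φ _ _ ih₁ ih₂ =>
    intro v V hV hΓ
    have h₁ : _ = _ := ih₁ v V hV hΓ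
    have h₂ := (realize_instN φ _ v V).1 (ih₂ v V hV hΓ)
    exact (realize_instN φ _ v V).2 (h₁ ▸ h₂)

theorem Provable.satisfies {T : Theory} {φ : Sentence} (h : Provable T φ) {M : Set (Set ℕ)}
    (hM : IsOmegaModel M T) : Satisfies M φ :=
  Derives.sound hM h _ _ (fun j => j.elim0) (by simp)

theorem satisfies_discreteOrderedSemiring (M : Set (Set ℕ)) :
    IsOmegaModel M discreteOrderedSemiring := by
  intro φ hφ
  simp only [discreteOrderedSemiring, Set.mem_insert_iff, Set.mem_singleton_iff] at hφ
  rcases hφ with rfl | rfl | rfl | rfl | rfl | rfl | rfl | rfl | rfl | rfl | rfl | rfl | rfl | rfl |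
    rfl | rfl | rfl <;> rw [satisfies_univClosure] <;> intro v V _ <;>
    simp only [realize_eq, realize_lt, realize_imp, realize_and, realize_or, realize_neg,
      realize_exN, leF, Term.eval_add, Term.eval_mul, Term.eval_var, Term.eval_zero,
      Term.eval_one, Term.eval_wk, Fin.cons_zero]
  · ring
  · ring
  · ring
  · ring
  · ring
  · ring
  · ring
  · ring
  · omega
  · omega
  · omega
  · omega
  · exact fun h => Nat.mul_lt_mul_of_pos_right h.2 h.1
  · exact fun h => ⟨v 1 - v 0, by omega⟩
  · exact Nat.one_pos
  · omega
  · omega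

theorem satisfies_inductionAxiom (M : Set (Set ℕ)) {n m : ℕ} (φ : Formula (n + 1) m) :
    Satisfies M (inductionAxiom φ) := by
  rw [inductionAxiom, satisfies_univClosure]
  intro v V _
  simp only [realize_imp, realize_and, realize_instN, realize_allN, realize_instSucc,
    Term.eval_zero]
  exact fun h a => Nat.rec h.1 h.2 a

end SOA

namespace SOA

open Formula Oracle

/-! ### Bounded formulas and comprehension -/

/-- A list of numbers as an assignment. -/
def assign (n : ℕ) (l : List ℕ) : Fin n → ℕ := fun i => l.getD i 0

theorem assign_cons (n a : ℕ) (l : List ℕ) : assign (n + 1) (a :: l) = Fin.cons a (assign n l) := by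
  funext i
  refine Fin.cases ?_ (fun i => ?_) i <;> simp [assign]

theorem assign_ofFn {n : ℕ} (v : Fin n → ℕ) : assign n (List.ofFn v) = v := by
  funext i
  simp [assign]

theorem Term.primrec_eval {n : ℕ} (t : Term n) : Primrec fun l => t.eval (assign n l) := by
  induction t with
  | var i => exact (Primrec.list_getD 0).comp Primrec.id (Primrec.const _)
  | zero => exact Primrec.const 0
  | one => exact Primrec.const 1
  | add t u iht ihu => exact Primrec.nat_add.comp iht ihu
  | mul t u iht ihu => exact Primrec.nat_mul.comp iht ihu

/-- Truth of a bounded formula whose set parameters are columns of the oracle is `Δ⁰₁`. -/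
theorem Formula.IsBounded.sigmaOne (M : Set (Set ℕ)) {n m : ℕ} {φ : Formula n m}
    (hφ : IsBounded φ) (c : Fin m → ℕ) :
    SigmaOne (fun H l => φ.Realize M (assign n l) fun j => H.col (c j)) ∧
      SigmaOne fun H l => ¬ φ.Realize M (assign n l) fun j => H.col (c j) := by
  classical
  have hdec : ∀ {p : List ℕ → Prop}, PrimrecPred p →
      SigmaOne (fun (_ : Oracle) l => p l) ∧ SigmaOne fun (_ : Oracle) l => ¬ p l :=
    fun hp => ⟨.of_primrec hp, .of_primrec hp.not⟩
  induction hφ with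
  | falsum =>
    exact hdec (p := fun _ => False) (primrecPred_iff_primrec_decide.2 (Primrec.const _))
  | eq t u => exact hdec (Primrec.eq.comp t.primrec_eval u.primrec_eval)
  | lt t u => exact hdec (Primrec.nat_lt.comp t.primrec_eval u.primrec_eval)
  | mem t X =>
    refine ⟨.get (Primrec.const _) t.primrec_eval true, (SigmaOne.get (i := fun _ => c X)
      (Primrec.const _) t.primrec_eval false).of_iff fun H l => ?_⟩
    simp [col]
  | imp _ _ ihφ ihψ =>
    refine ⟨(ihφ c).2.imp (ihψ c).1, ((ihφ c).1.and (ihψ c).2).of_iff fun H l => ?_⟩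
    simp
  | @ball n m t φ _ ih =>
    have hc : Primrec fun q : List ℕ × ℕ => q.2 :: q.1 :=
      Primrec.list_cons.comp Primrec.snd Primrec.fst
    constructor
    · refine (SigmaOne.ball (P := fun H l a => φ.Realize M (assign (n + 1) (a :: l))
        fun j => H.col (c j)) ((ih c).1.comp hc) t.primrec_eval).of_iff fun H l => ?_
      simp [assign_cons]
    · refine (SigmaOne.ex (P := fun H l a => a < t.eval (assign n l) ∧
        ¬ φ.Realize M (assign (n + 1) (a :: l)) fun j => H.col (c j))
        (.and (.of_primrec (Primrec.nat_lt.comp Primrec.snd (t.primrec_eval.comp Primrec.fst)))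
          ((ih c).2.comp hc))).of_iff fun H l => ?_
      simp [assign_cons]

theorem exists_forall_lt {m : ℕ} (c : Fin m → ℕ) : ∃ b, ∀ j, c j < b :=
  ⟨Finset.univ.sup c + 1, fun j => Nat.lt_succ_of_le (Finset.le_sup (Finset.mem_univ j))⟩

theorem Oracle.col_congr {G G' : Oracle} {i : ℕ} (h : G i = G' i) : G.col i = G'.col i := by
  simp [col, h]

namespace IsGeneric

variable {G : Oracle} (hG : IsGeneric G)

include hG

/-- Sets that are `Δ⁰₁` relative to finitely many columns are columns. -/
theorem mem_model {A B : Oracle → ℕ → Prop} (hA : SigmaOne A) (hB : SigmaOne B) {c : ℕ}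
    (hAc : DependsBelow A c) (hBc : DependsBelow B c) (h : ∀ x, B G x ↔ ¬ A G x) :
    {x | A G x} ∈ G.model := by
  classical
  -- the first column of `H` differs from the set to be found, relative to the other columns
  let P : Oracle → Unit → Prop := fun H _ => ∃ x,
    (A (fun i => H (i + 1)) x ∧ H 0 x = false) ∨ (B (fun i => H (i + 1)) x ∧ H 0 x = true)
  have hP : SigmaOne P := SigmaOne.ex (.or
    (.and ((hA.reindex Primrec.succ).comp Primrec.snd) (.get (Primrec.const 0) Primrec.snd _))
    (.and ((hB.reindex Primrec.succ).comp Primrec.snd) (.get (Primrec.const 0) Primrec.snd _)))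
  have hPc : DependsBelow P (c + 1) := by
    rintro H H' hH _ ⟨x, h | h⟩
    · exact ⟨x, Or.inl ⟨hAc _ _ (fun i hi => hH _ (by omega)) _ h.1, hH 0 (by omega) ▸ h.2⟩⟩
    · exact ⟨x, Or.inr ⟨hBc _ _ (fun i hi => hH _ (by omega)) _ h.1, hH 0 (by omega) ▸ h.2⟩⟩
  obtain ⟨j, hj⟩ := hG.column P _ hP hPc ⟨fun x => decide (A G x), by
    rintro ⟨x, ⟨hA, hx⟩ | ⟨hB, hx⟩⟩
    · simp [cons] at hx
      exact hx hA
    · simp [cons] at hx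
      exact (h x).1 hB hx⟩
  refine ⟨j, Set.ext fun x => ?_⟩
  have := not_exists.1 hj x
  simp only [cons, not_or, not_and] at this
  simp only [col, Set.mem_ofPred_eq]
  constructor
  · intro hx
    by_contra hA
    exact this.2 ((h x).2 hA) hx
  · intro hA
    by_contra hx
    exact this.1 hA (by simpa using hx)

theorem satisfies_comprehensionAxiom {n m : ℕ} {φ ψ : Formula (n + 1) m} (hφ : φ.IsSigma1)
    (hψ : ψ.IsPi1) : Satisfies G.model (comprehensionAxiom φ ψ) := by
  obtain ⟨θ, hθ, rfl⟩ := hφ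
  obtain ⟨η, hη, rfl⟩ := hψ
  rw [comprehensionAxiom, satisfies_univClosure]
  intro v V hV
  simp only [realize_imp, realize_allN, realize_iff, realize_exS, realize_mem, realize_wkS,
    Term.eval_var, Fin.cons_zero]
  intro h
  choose c hc using hV
  obtain rfl : (fun j => G.col (c j)) = V := funext hc
  obtain ⟨b, hb⟩ := exists_forall_lt c
  have hcons : Primrec fun q : ℕ × ℕ => q.2 :: q.1 :: List.ofFn v :=
    Primrec.list_cons.comp Primrec.snd (Primrec.list_cons.comp Primrec.fst (Primrec.const _))
  have hdep : ∀ {H H' : Oracle}, (∀ i < b, H i = H' i) →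
      (fun j => H.col (c j)) = fun j => H'.col (c j) :=
    fun hH => funext fun j => col_congr (hH _ (hb j))
  have key := hG.mem_model (c := b)
    (A := fun H x => ∃ y, θ.Realize G.model (assign (n + 2) (y :: x :: List.ofFn v))
      fun j => H.col (c j))
    (B := fun H x => ∃ y, ¬ η.Realize G.model (assign (n + 2) (y :: x :: List.ofFn v))
      fun j => H.col (c j))
    (.ex ((hθ.sigmaOne G.model c).1.comp hcons)) (.ex ((hη.sigmaOne G.model c).2.comp hcons))
    (fun H H' hH x => by simp only [hdep hH, imp_self])
    (fun H H' hH x => by simp only [hdep hH, imp_self]) (fun x => by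
      have := h x
      simp only [realize_exN] at this
      simp only [assign_cons, assign_ofFn, this]
      push Not
      rfl)
  refine ⟨_, key, fun x => ?_⟩
  simp [assign_cons, assign_ofFn]

theorem isOmegaModel_RCA0 : IsOmegaModel G.model RCA0 := by
  rintro φ ((h | ⟨n, m, φ, -, rfl⟩) | ⟨n, m, φ, ψ, hφ, hψ, rfl⟩)
  · exact satisfies_discreteOrderedSemiring _ φ h
  · exact satisfies_inductionAxiom _ φ
  · exact hG.satisfies_comprehensionAxiom hφ hψ

end IsGeneric

/-! ### Weak König's lemma -/

/-- König's lemma for trees of codes of binary strings. The code of the empty string is `1`, and a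
string with code `s` has the immediate extensions `2 * s` and `2 * s + 1`; so the strings of length
`k` have the codes from `2 ^ k` to `2 ^ (k + 1) - 1`, and `t` extends `s` iff `t / 2 ^ j = s` for
some `j`. -/
theorem exists_path {T : Set ℕ} (hpos : ∀ x ∈ T, 0 < x)
    (htree : ∀ x, 0 < x → (x + x ∈ T ∨ x + x + 1 ∈ T) → x ∈ T) (hinf : ∀ k, ∃ s, k < s ∧ s ∈ T) :
    ∃ P : Set ℕ, P ⊆ T ∧ (∀ x, 0 < x → (x + x ∈ P ∨ x + x + 1 ∈ P) → x ∈ P) ∧ 1 ∈ P ∧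
      ∀ x ∈ P, (x + x ∈ P ↔ x + x + 1 ∉ P) := by
  classical
  -- `big s`: the string coded by `s` has infinitely many extensions in `T`
  let big : ℕ → Prop := fun s => ∀ k, ∃ t, k < t ∧ t ∈ T ∧ ∃ j, t / 2 ^ j = s
  have hbig1 : big 1 := by
    intro k
    obtain ⟨t, hkt, ht⟩ := hinf k
    have := hpos t ht
    refine ⟨t, hkt, ht, Nat.log 2 t, ?_⟩
    have h₁ := Nat.pow_log_le_self 2 this.ne'
    have h₂ := Nat.lt_pow_succ_log_self one_lt_two t
    refine le_antisymm ?_ ((Nat.one_le_div_iff (by positivity)).2 h₁)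
    rw [pow_succ] at h₂
    exact Nat.lt_succ_iff.1 ((Nat.div_lt_iff_lt_mul (by positivity)).2 (by omega))
  have hbig : ∀ s, big s → ¬ big (s + s) → big (s + s + 1) := by
    intro s hs h k
    simp only [big, not_forall, not_exists, not_and] at h
    obtain ⟨k₀, hk₀⟩ := h
    obtain ⟨t, hkt, ht, j, hj⟩ := hs (max (max k k₀) s)
    simp only [max_lt_iff] at hkt
    rcases j with _ | j
    · simp at hj
      omega
    · refine ⟨t, hkt.1.1, ht, j, ?_⟩
      have := hk₀ t hkt.1.2 ht j
      rw [pow_succ, ← Nat.div_div_eq_div_mul] at hj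
      omega
  have hT : ∀ s, 0 < s → big s → s ∈ T := by
    intro s hs h
    obtain ⟨t, -, ht, j, hj⟩ := h 0
    clear h
    subst hj
    induction j with
    | zero => simpa using ht
    | succ j ih =>
      rw [pow_succ, ← Nat.div_div_eq_div_mul] at hs ⊢
      have := ih (by omega)
      refine htree _ hs ?_
      rcases Nat.even_or_odd' (t / 2 ^ j) with ⟨c, hc | hc⟩
      · left
        rwa [show t / 2 ^ j / 2 + t / 2 ^ j / 2 = t / 2 ^ j by omega]
      · right
        rwa [show t / 2 ^ j / 2 + t / 2 ^ j / 2 + 1 = t / 2 ^ j by omega]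
  -- the path, leftmost among the strings with infinitely many extensions in `T`
  let p : ℕ → ℕ := fun k => Nat.rec 1 (fun _ s => if big (s + s) then s + s else s + s + 1) k
  have hp : ∀ k, p (k + 1) = if big (p k + p k) then p k + p k else p k + p k + 1 := fun _ => rfl
  have hpb : ∀ k, big (p k) := by
    intro k
    induction k with
    | zero => exact hbig1
    | succ k ih =>
      rw [hp]
      split_ifs with h
      · exact h
      · exact hbig _ ih h
  have hplog : ∀ k, 2 ^ k ≤ p k ∧ p k < 2 ^ (k + 1) := by
    intro k
    induction k with
    | zero => exact ⟨le_rfl, one_lt_two⟩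
    | succ k ih =>
      rw [hp, pow_succ 2 (k + 1), pow_succ]
      split_ifs <;> omega
  have hpp : ∀ k, 0 < p k := fun k => lt_of_lt_of_le (by positivity) (hplog k).1
  -- siblings have the same length, so at most one of them is on the path
  have hlevel : ∀ {a b : ℕ}, p a / 2 = p b / 2 → a = b := by
    intro a b hab
    have hlog : ∀ k, p k / 2 = 0 ∧ k = 0 ∨ 0 < k ∧ 2 ^ (k - 1) ≤ p k / 2 ∧ p k / 2 < 2 ^ k := by
      intro k
      have := hplog k
      rcases k with _ | k
      · left
        simp [p]
      · right
        rw [pow_succ 2 (k + 1), pow_succ] at this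
        simp only [Nat.add_sub_cancel, pow_succ]
        omega
    by_contra hne
    wlog hlt : a < b generalizing a b
    · exact this hab.symm (Ne.symm hne) (by omega)
    rcases hlog b with h | ⟨-, hb, -⟩
    · omega
    · have h2 : 2 ^ a ≤ 2 ^ (b - 1) := Nat.pow_le_pow_right two_pos (by omega)
      have : 0 < 2 ^ a := by positivity
      rcases hlog a with h | h <;> omega
  refine ⟨Set.range p, ?_, ?_, ⟨0, rfl⟩, ?_⟩
  · rintro _ ⟨k, rfl⟩
    exact hT _ (hpp k) (hpb k)
  · rintro x hx (⟨k, hk⟩ | ⟨k, hk⟩) <;> rcases k with _ | k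
    · simp [p] at hk
      omega
    · rw [hp] at hk
      exact ⟨k, by split_ifs at hk <;> omega⟩
    · simp [p] at hk
      omega
    · rw [hp] at hk
      exact ⟨k, by split_ifs at hk <;> omega⟩
  · rintro _ ⟨k, rfl⟩
    constructor
    · rintro ⟨a, ha⟩ ⟨b, hb⟩
      obtain rfl : a = b := hlevel (by omega)
      omega
    · intro h
      refine ⟨k + 1, ?_⟩
      rw [hp]
      split_ifs with h'
      · rfl
      · exact absurd ⟨k + 1, by rw [hp, if_neg h']⟩ h

theorem IsGeneric.satisfies_weakKonigLemma {G : Oracle} (hG : IsGeneric G) :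
    Satisfies G.model weakKonigLemma := by
  classical
  rintro _ ⟨i, rfl⟩
  simp only [realize_imp, realize_and, realize_exS]
  rintro ⟨htree, hinf⟩
  -- the matrix of `infinitePath 0 1`, a `Π⁰₁` formula
  let θ : Formula 1 2 := (.var 0 ∈ₗ 0 ⟶ₗ .var 0 ∈ₗ 1) ∧ₗ (.var 0 ∈ₗ 0 ⟶ₗ 0 <ₗ .var 0) ∧ₗ
    (0 <ₗ .var 0 ∧ₗ (child0 (.var 0) ∈ₗ 0 ∨ₗ child1 (.var 0) ∈ₗ 0) ⟶ₗ .var 0 ∈ₗ 0) ∧ₗ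
    1 ∈ₗ 0 ∧ₗ (.var 0 ∈ₗ 0 ⟶ₗ (child0 (.var 0) ∈ₗ 0 ⟷ₗ neg (child1 (.var 0) ∈ₗ 0)))
  have hθb : IsBounded θ := by
    simp only [θ, Formula.and, Formula.or, Formula.iff, Formula.neg]
    repeat constructor
  have hθ : ∀ (X Y : Set ℕ),
      (infinitePath 0 1).Realize G.model Fin.elim0
        (Fin.cons Y (Fin.cons X Fin.elim0) : Fin 2 → Set ℕ) ↔
      ∀ a, θ.Realize G.model (assign 1 [a]) (Fin.cons Y (Fin.cons X Fin.elim0)) := by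
    intro X Y
    simp only [infinitePath, binaryTree, θ, realize_and, realize_allN, realize_imp, forall_and]
    simp only [assign_cons, Subsingleton.elim (assign 0 []) Fin.elim0, realize_mem, realize_lt,
      realize_or, realize_iff, realize_neg, child0, child1, Term.eval_var, Term.eval_add,
      Term.eval_one, Fin.cons_zero, forall_const]
    tauto
  let c : Fin 2 → ℕ := ![0, i + 1]
  have hcol : ∀ Y, (fun j => (cons Y G).col (c j)) =
      Fin.cons {x | Y x = true} (Fin.cons (G.col i) Fin.elim0) := by
    intro Y
    funext j
    refine Fin.cases rfl (fun j => Fin.cases rfl (fun j => j.elim0) j) j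
  have hcons : Primrec fun q : Unit × ℕ => [q.2] :=
    Primrec.list_cons.comp Primrec.snd (Primrec.const [])
  obtain ⟨j, hj⟩ := hG.column
    (fun H _ => ∃ a, ¬ θ.Realize G.model (assign 1 [a]) fun j => H.col (c j)) (i + 2)
    (.ex ((hθb.sigmaOne G.model c).2.comp hcons)) (by
      rintro H H' hH _ ⟨a, ha⟩
      refine ⟨a, ?_⟩
      have : (fun j => H'.col (c j)) = fun j => H.col (c j) := by
        funext j
        refine col_congr (hH _ ?_).symm
        fin_cases j <;> simp [c]
      rwa [this]) (by
      simp only [binaryTree, infiniteSet, child0, child1, realize_and, realize_allN, realize_imp,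
        realize_exN, realize_mem, realize_lt, realize_or, Term.eval_var, Term.eval_add,
        Term.eval_zero, Term.eval_one, Fin.cons_zero, Fin.cons_one] at htree hinf
      obtain ⟨P, hPT, hP, h1, hpath⟩ := exists_path (T := G.col i) htree.1
        (fun x hx h => htree.2 x ⟨hx, h⟩) hinf
      have hreal := (hθ (G.col i) P).1 (by
        simp only [infinitePath, binaryTree, child0, child1, realize_and, realize_allN,
          realize_imp, realize_mem, realize_lt, realize_or, realize_iff, realize_neg,
          Term.eval_var, Term.eval_add, Term.eval_zero, Term.eval_one, Fin.cons_zero,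
          Fin.cons_one]
        exact ⟨hPT, ⟨fun x hx => htree.1 x (hPT hx), fun x hx => hP x hx.1 hx.2⟩, h1, hpath⟩)
      refine ⟨fun x => decide (x ∈ P), not_exists.2 fun a ha => ha ?_⟩
      rw [hcol]
      simpa using hreal a)
  refine ⟨G.col j, ⟨j, rfl⟩, (hθ _ _).2 fun a => ?_⟩
  have := not_exists_not.1 hj a
  rwa [hcol] at this

theorem IsGeneric.isOmegaModel_WKL0 {G : Oracle} (hG : IsGeneric G) :
    IsOmegaModel G.model WKL0 := by
  rintro φ (h | h)
  · exact hG.isOmegaModel_RCA0 φ h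
  · rw [Set.mem_singleton_iff.1 h]
    exact hG.satisfies_weakKonigLemma

end SOA

namespace SOA

open Nat.Partrec (Code)

/-! ### A computably enumerable graph -/

namespace LinkGraph

/-- The level of a vertex. -/
def level (v : ℕ) : ℕ := v.unpair.1

/-- The finite set of vertices of lower level that the vertex `v` declares, as a list. -/
def declared (v : ℕ) : List ℕ :=
  (Denumerable.ofNat (List ℕ) v.unpair.2).filter fun z => level z < level v

/-- A code of the partial computable function attached to level `n`; each one is attached to infinitely
many levels. -/
def levelCode (n : ℕ) : Code := Denumerable.ofNat Code n.unpair.1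

/-- Within `s` steps, the function of level `n` is seen to take values below `s` at all
arguments up to `y`. -/
def ConvBy (s n y : ℕ) : Prop := ∀ i < y + 1, ∃ a < s, Code.evaln s (levelCode n) i = some a

/-- The function of level `n` is defined at all arguments up to `y`. -/
def Conv (n y : ℕ) : Prop := ∃ s, ConvBy s n y

/-- The condition for the finite set `L` of edges to be correct at its element `p` at stage `s`,
the reversed pair being required as well. If
`p.1` has at most the level of `p.2`, then `p.1` and the vertices declared by `p.2` must already
form a clique; moreover either `p.2` declares `p.1`, or the function of the level of `p.1` has
converged on an initial segment reaching beyond `p.2`. -/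
def Admissible (s : ℕ) (L : List (ℕ × ℕ)) (p : ℕ × ℕ) : Prop :=
  p.1 ≠ p.2 ∧ (p.2, p.1) ∈ L ∧
    (level p.1 ≤ level p.2 → (∀ z ∈ declared p.2, z ≠ p.1 → (z, p.1) ∈ L) ∧
      (∀ z ∈ declared p.2, ∀ w ∈ declared p.2, z ≠ w → (z, w) ∈ L) ∧
      (p.1 ∈ declared p.2 ∨ ConvBy s (level p.1) (p.2 + 1)))

/-- `c` codes a stage and a finite set of edges which witnesses that `x` and `y` are linked. -/
def IsWitness (c x y : ℕ) : Prop :=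
  (∀ p ∈ Denumerable.ofNat (List (ℕ × ℕ)) c.unpair.2,
    Admissible c.unpair.1 (Denumerable.ofNat (List (ℕ × ℕ)) c.unpair.2) p) ∧
  (x, y) ∈ Denumerable.ofNat (List (ℕ × ℕ)) c.unpair.2

/-- `x` and `y` are linked by an edge that has been enumerated by stage `t`. -/
def LinkedBy (t x y : ℕ) : Prop := ∃ c < t + 1, IsWitness c x y

/-- `x` and `y` are linked by an edge. -/
def Linked (x y : ℕ) : Prop := ∃ c, IsWitness c x y

/-! ### The graph is primitive recursively enumerated -/

theorem primrec_level : Primrec level := Primrec.fst.comp Primrec.unpair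

theorem primrec_declared : Primrec declared := by
  have h : PrimrecRel fun z v : ℕ => level z < level v :=
    Primrec.nat_lt.comp (primrec_level.comp Primrec.fst) (primrec_level.comp Primrec.snd)
  exact h.listFilter.comp
    ((Primrec.ofNat _).comp (Primrec.snd.comp Primrec.unpair)) Primrec.id

theorem primrecPred_convBy {α : Type} [Primcodable α] {s n y : α → ℕ} (hs : Primrec s)
    (hn : Primrec n) (hy : Primrec y) : PrimrecPred fun a => ConvBy (s a) (n a) (y a) := by
  refine primrecPred_forall_lt (R := fun a i => ∃ b < s a,
    Code.evaln (s a) (levelCode (n a)) i = some b) (Primrec.succ.comp hy) ?_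
  refine primrecPred_exists_lt (f := fun q : α × ℕ => s q.1) (R := fun q b =>
    Code.evaln (s q.1) (levelCode (n q.1)) q.2 = some b) (hs.comp Primrec.fst) ?_
  have hc : Primrec levelCode := (Primrec.ofNat _).comp (Primrec.fst.comp Primrec.unpair)
  have h := Code.primrec_evaln.comp
    (((hs.comp Primrec.fst).pair (hc.comp (hn.comp Primrec.fst))).pair
      (Primrec.snd : Primrec fun q : α × ℕ => q.2))
  exact Primrec.eq.comp (h.comp Primrec.fst) (Primrec.option_some.comp Primrec.snd)

theorem primrecPred_isWitness : PrimrecPred fun q : ℕ × ℕ × ℕ => IsWitness q.1 q.2.1 q.2.2 := by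
  have hL : Primrec fun c : ℕ => Denumerable.ofNat (List (ℕ × ℕ)) c.unpair.2 :=
    (Primrec.ofNat _).comp (Primrec.snd.comp Primrec.unpair)
  have hs : Primrec fun c : ℕ => c.unpair.1 := Primrec.fst.comp Primrec.unpair
  refine PrimrecPred.and (PrimrecPred.comp
    (p := fun c : ℕ => ∀ p ∈ Denumerable.ofNat (List (ℕ × ℕ)) c.unpair.2,
      Admissible c.unpair.1 (Denumerable.ofNat (List (ℕ × ℕ)) c.unpair.2) p) ?_ Primrec.fst)
    (primrecPred_mem (hL.comp Primrec.fst) Primrec.snd)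
  refine primrecPred_forall_mem (R := fun c p => Admissible c.unpair.1
    (Denumerable.ofNat (List (ℕ × ℕ)) c.unpair.2) p) hL ?_
  have h1 : Primrec fun q : ℕ × ℕ × ℕ => q.2.1 := Primrec.fst.comp Primrec.snd
  have h2 : Primrec fun q : ℕ × ℕ × ℕ => q.2.2 := Primrec.snd.comp Primrec.snd
  have hL' := hL.comp (Primrec.fst : Primrec fun q : ℕ × ℕ × ℕ => q.1)
  refine (Primrec.eq.comp h1 h2).not.and (.and (primrecPred_mem hL' (h2.pair h1))
    (primrecPred_imp (Primrec.nat_le.comp (primrec_level.comp h1) (primrec_level.comp h2))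
      (.and ?_ (.and ?_ (.or (primrecPred_mem (primrec_declared.comp h2) h1)
        (primrecPred_convBy (hs.comp Primrec.fst) (primrec_level.comp h1)
          (Primrec.succ.comp h2)))))))
  · refine primrecPred_forall_mem (R := fun (q : ℕ × ℕ × ℕ) z => z ≠ q.2.1 → (z, q.2.1) ∈
      Denumerable.ofNat (List (ℕ × ℕ)) q.1.unpair.2) (primrec_declared.comp h2) ?_
    exact primrecPred_imp (Primrec.eq.comp Primrec.snd (h1.comp Primrec.fst)).not
      (primrecPred_mem (hL'.comp Primrec.fst) (Primrec.snd.pair (h1.comp Primrec.fst)))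
  · refine primrecPred_forall_mem (R := fun (q : ℕ × ℕ × ℕ) z => ∀ w ∈ declared q.2.2, z ≠ w →
      (z, w) ∈ Denumerable.ofNat (List (ℕ × ℕ)) q.1.unpair.2) (primrec_declared.comp h2) ?_
    refine primrecPred_forall_mem (R := fun (q : (ℕ × ℕ × ℕ) × ℕ) w => q.2 ≠ w →
      (q.2, w) ∈ Denumerable.ofNat (List (ℕ × ℕ)) q.1.1.unpair.2)
      (primrec_declared.comp (h2.comp Primrec.fst)) ?_
    exact primrecPred_imp (Primrec.eq.comp (Primrec.snd.comp Primrec.fst) Primrec.snd).not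
      (primrecPred_mem (hL'.comp (Primrec.fst.comp Primrec.fst))
        ((Primrec.snd.comp Primrec.fst).pair Primrec.snd))

theorem primrecPred_linkedBy {α : Type} [Primcodable α] {t x y : α → ℕ} (ht : Primrec t)
    (hx : Primrec x) (hy : Primrec y) : PrimrecPred fun a => LinkedBy (t a) (x a) (y a) := by
  refine primrecPred_exists_lt (R := fun a c => IsWitness c (x a) (y a)) (Primrec.succ.comp ht) ?_
  exact primrecPred_isWitness.comp
    (Primrec.snd.pair ((hx.comp Primrec.fst).pair (hy.comp Primrec.fst)))

/-! ### Introducing and eliminating edges -/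

theorem level_lt_of_mem_declared {z v : ℕ} (h : z ∈ declared v) : level z < level v := by
  simpa using (List.mem_filter.1 h).2

theorem ConvBy.mono {s t n y : ℕ} (hst : s ≤ t) (h : ConvBy s n y) : ConvBy t n y := by
  intro i hi
  obtain ⟨a, ha, hia⟩ := h i hi
  exact ⟨a, ha.trans_le hst, Code.evaln_mono hst hia⟩

theorem ConvBy.of_le {s n y z : ℕ} (hzy : z ≤ y) (h : ConvBy s n y) : ConvBy s n z :=
  fun i hi => h i (by omega)

theorem Admissible.mono {s t : ℕ} {L L' : List (ℕ × ℕ)} {p : ℕ × ℕ} (hst : s ≤ t) (hL : L ⊆ L')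
    (h : Admissible s L p) : Admissible t L' p := by
  refine ⟨h.1, hL h.2.1, fun hl => ?_⟩
  obtain ⟨h₁, h₂, h₃⟩ := h.2.2 hl
  exact ⟨fun z hz hzp => hL (h₁ z hz hzp), fun z hz w hw hzw => hL (h₂ z hz w hw hzw),
    h₃.imp_right (ConvBy.mono hst)⟩

theorem LinkedBy.linked {t x y : ℕ} (h : LinkedBy t x y) : Linked x y :=
  h.imp fun _ hc => hc.2

theorem Linked.exists_linkedBy {x y : ℕ} (h : Linked x y) : ∃ t, LinkedBy t x y :=
  h.imp fun c hc => ⟨c, Nat.lt_succ_self c, hc⟩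

theorem LinkedBy.mono {s t x y : ℕ} (hst : s ≤ t) (h : LinkedBy s x y) : LinkedBy t x y := by
  obtain ⟨c, hc, h⟩ := h
  exact ⟨c, by omega, h⟩

section LinkedBy

variable {t x y : ℕ}

theorem LinkedBy.symm (h : LinkedBy t x y) : LinkedBy t y x := by
  obtain ⟨c, hc, h, hxy⟩ := h
  exact ⟨c, hc, h, (h _ hxy).2.1⟩

theorem LinkedBy.declared_left (h : LinkedBy t x y) (hl : level x ≤ level y) {z : ℕ}
    (hz : z ∈ declared y) (hzx : z ≠ x) : LinkedBy t z x := by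
  obtain ⟨c, hc, h, hxy⟩ := h
  exact ⟨c, hc, h, ((h _ hxy).2.2 hl).1 z hz hzx⟩

theorem LinkedBy.declared_declared (h : LinkedBy t x y) (hl : level x ≤ level y) {z w : ℕ}
    (hz : z ∈ declared y) (hw : w ∈ declared y) (hzw : z ≠ w) : LinkedBy t z w := by
  obtain ⟨c, hc, h, hxy⟩ := h
  exact ⟨c, hc, h, ((h _ hxy).2.2 hl).2.1 z hz w hw hzw⟩

theorem LinkedBy.mem_or_convBy (h : LinkedBy t x y) (hl : level x ≤ level y) :
    x ∈ declared y ∨ ConvBy t (level x) (y + 1) := by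
  obtain ⟨c, hc, h, hxy⟩ := h
  refine ((h _ hxy).2.2 hl).2.2.imp_right (ConvBy.mono ?_)
  have := Nat.unpair_left_le c
  omega

end LinkedBy

theorem Linked.symm {x y : ℕ} (h : Linked x y) : Linked y x :=
  h.exists_linkedBy.elim fun _ h => h.symm.linked

theorem Linked.declared_left {x y z : ℕ} (h : Linked x y) (hl : level x ≤ level y)
    (hz : z ∈ declared y) (hzx : z ≠ x) : Linked z x :=
  h.exists_linkedBy.elim fun _ h => (h.declared_left hl hz hzx).linked

theorem Linked.declared_declared {x y z w : ℕ} (h : Linked x y) (hl : level x ≤ level y)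
    (hz : z ∈ declared y) (hw : w ∈ declared y) (hzw : z ≠ w) : Linked z w :=
  h.exists_linkedBy.elim fun _ h => (h.declared_declared hl hz hw hzw).linked

/-- Finitely many edges have a common witness. -/
theorem exists_common_witness (S : List (ℕ × ℕ)) (hS : ∀ p ∈ S, Linked p.1 p.2) :
    ∃ s L, (∀ p ∈ L, Admissible s L p) ∧ S ⊆ L := by
  induction S with
  | nil => exact ⟨0, [], by simp, by simp⟩
  | cons p S ih =>
    obtain ⟨s, L, hL, hSL⟩ := ih fun q hq => hS q (List.mem_cons_of_mem _ hq)
    obtain ⟨c, hc, hp⟩ := hS p List.mem_cons_self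
    refine ⟨max s c.unpair.1, L ++ Denumerable.ofNat (List (ℕ × ℕ)) c.unpair.2, ?_, ?_⟩
    · intro q hq
      rcases List.mem_append.1 hq with hq | hq
      · exact (hL q hq).mono (le_max_left _ _) (List.subset_append_left _ _)
      · exact (hc q hq).mono (le_max_right _ _) (List.subset_append_right _ _)
    · refine List.cons_subset.2 ⟨List.mem_append_right _ hp, ?_⟩
      exact List.Subset.trans hSL (List.subset_append_left _ _)

/-- The condition on the pair `x`, `y` for an edge between them, in the limit. -/
def Joinable (x y : ℕ) : Prop :=
  level x ≤ level y → (∀ z ∈ declared y, z ≠ x → Linked z x) ∧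
    (∀ z ∈ declared y, ∀ w ∈ declared y, z ≠ w → Linked z w) ∧
    (x ∈ declared y ∨ Conv (level x) (y + 1))

theorem Linked.intro {x y : ℕ} (hne : x ≠ y) (hxy : Joinable x y) (hyx : Joinable y x) :
    Linked x y := by
  classical
  -- all edges whose presence is required, if the levels of `a` and `b` are in the right order
  let req : ℕ → ℕ → List (ℕ × ℕ) := fun a b => if level a ≤ level b then
    ((a :: declared b).product (a :: declared b)).filter (fun p => Linked p.1 p.2) else []
  have hreq : ∀ a b, Joinable a b → ∃ s₀, ∀ s L, s₀ ≤ s → req a b ⊆ L → (b, a) ∈ L → a ≠ b →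
      Admissible s L (a, b) := by
    intro a b hab
    by_cases hl : level a ≤ level b
    · obtain ⟨h₁, h₂, h₃⟩ := hab hl
      have hmem : ∀ {L : List (ℕ × ℕ)} {z w}, req a b ⊆ L → z ∈ a :: declared b →
          w ∈ a :: declared b → Linked z w → (z, w) ∈ L := by
        intro L z w hL hz hw hzw
        refine hL ?_
        simp only [req, if_pos hl]
        exact List.mem_filter.2 ⟨List.mem_product.2 ⟨hz, hw⟩, by simpa using hzw⟩
      obtain ⟨s₀, hs₀⟩ : ∃ s₀, a ∈ declared b ∨ ConvBy s₀ (level a) (b + 1) := by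
        rcases h₃ with h₃ | ⟨s, hs⟩
        · exact ⟨0, Or.inl h₃⟩
        · exact ⟨s, Or.inr hs⟩
      refine ⟨s₀, fun s L hs hL hba hne => ⟨hne, hba, fun _ => ⟨?_, ?_, ?_⟩⟩⟩
      · exact fun z hz hza => hmem hL (List.mem_cons_of_mem _ hz) List.mem_cons_self (h₁ z hz hza)
      · exact fun z hz w hw hzw => hmem hL (List.mem_cons_of_mem _ hz)
          (List.mem_cons_of_mem _ hw) (h₂ z hz w hw hzw)
      · exact hs₀.imp_right (ConvBy.mono hs)
    · exact ⟨0, fun s L _ _ hba hne => ⟨hne, hba, fun h => absurd h hl⟩⟩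
  have hreql : ∀ a b, ∀ p ∈ req a b, Linked p.1 p.2 := by
    intro a b p hp
    simp only [req] at hp
    split_ifs at hp
    · simpa using (List.mem_filter.1 hp).2
    · simp at hp
  obtain ⟨s₁, h₁⟩ := hreq x y hxy
  obtain ⟨s₂, h₂⟩ := hreq y x hyx
  obtain ⟨s, L, hL, hS⟩ := exists_common_witness (req x y ++ req y x) fun p hp =>
    (List.mem_append.1 hp).elim (hreql _ _ p) (hreql _ _ p)
  rw [List.append_subset] at hS
  let t := max s (max s₁ s₂)
  let L' := (x, y) :: (y, x) :: L
  have hLL : L ⊆ L' :=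
    List.Subset.trans (List.subset_cons_self _ _) (List.subset_cons_self _ _)
  refine ⟨Nat.pair t (Encodable.encode L'), ?_, ?_⟩
  · simp only [Nat.unpair_pair, Denumerable.ofNat_encode]
    intro p hp
    rcases List.mem_cons.1 hp with rfl | hp
    · exact h₁ t L' (by omega) (List.Subset.trans hS.1 hLL) (by simp [L']) hne
    rcases List.mem_cons.1 hp with rfl | hp
    · exact h₂ t L' (by omega) (List.Subset.trans hS.2 hLL) (by simp [L']) hne.symm
    · exact (hL p hp).mono (by omega) hLL
  · simp [L']

end LinkGraph

end SOA

namespace SOA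

open Nat.Partrec (Code)

namespace LinkGraph

/-! ### Maximal cliques contain vertices of every total level -/

/-- The function attached to level `n` is total. -/
def TotalLevel (n : ℕ) : Prop := ∀ y, Conv n y

/-- `a` and `b` are equal or linked. -/
def Near (a b : ℕ) : Prop := a = b ∨ Linked a b

theorem Near.symm {a b : ℕ} (h : Near a b) : Near b a := h.imp Eq.symm Linked.symm

theorem Near.linked {a b : ℕ} (h : Near a b) (hne : a ≠ b) : Linked a b := h.resolve_left hne

/-- `K` is a maximal clique of the graph. -/
structure IsMaximalClique (K : Set ℕ) : Prop where
  linked : ∀ a ∈ K, ∀ b ∈ K, a ≠ b → Linked a b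
  mem : ∀ v, (∀ x ∈ K, v ≠ x → Linked v x) → v ∈ K

theorem IsMaximalClique.near {K : Set ℕ} (hK : IsMaximalClique K) {a b : ℕ} (ha : a ∈ K)
    (hb : b ∈ K) : Near a b :=
  or_iff_not_imp_left.2 (hK.linked a ha b hb)

/-- The vertices obtained from `K` by repeatedly passing from a vertex of level at least `n` to
those it declares. -/
inductive Reach (K : Set ℕ) (n : ℕ) : ℕ → Prop
  | base {x : ℕ} : x ∈ K → Reach K n x
  | step {y u : ℕ} : Reach K n y → n ≤ level y → u ∈ declared y → Reach K n u

/-- The vertices of level at most `n` obtained from `k` by repeatedly passing from a vertex of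
level at least `n` to those it declares. -/
inductive Low (n : ℕ) : ℕ → ℕ → Prop
  | self {k : ℕ} : level k ≤ n → Low n k k
  | step {k u a : ℕ} : n ≤ level k → u ∈ declared k → Low n u a → Low n k a

section Reach

variable {K : Set ℕ} (hK : IsMaximalClique K) {n x₀ : ℕ} (hx₀ : x₀ ∈ K) (hn : level x₀ < n)

theorem Reach.exists_low {a : ℕ} (h : Reach K n a) (ha : level a ≤ n) : ∃ k ∈ K, Low n k a := by
  suffices ∀ y, Reach K n y → ∃ k ∈ K, ∀ a, Low n y a → Low n k a by
    obtain ⟨k, hk, hka⟩ := this a h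
    exact ⟨k, hk, hka a (.self ha)⟩
  intro y hy
  induction hy with
  | base h => exact ⟨_, h, fun _ ha => ha⟩
  | step _ hl hu ih =>
    obtain ⟨k, hk, hka⟩ := ih
    exact ⟨k, hk, fun a ha => hka a (.step hl hu ha)⟩

include hK hx₀ hn

/-- Reachable vertices of level at least `n` remain linked to the base point `x₀`, whose level is
below `n`: an edge from a vertex to `x₀` passes on to the declared vertices. -/
theorem Reach.linked_base {y : ℕ} (h : Reach K n y) (hy : n ≤ level y) : Linked x₀ y := by
  induction h with
  | base h => exact hK.linked _ hx₀ _ h (by rintro rfl; omega)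
  | @step y u _ hl hu ih =>
    exact ((ih hl).declared_left (by omega) hu (by rintro rfl; omega)).symm

theorem Reach.near_of_declared {y z w : ℕ} (h : Reach K n y) (hy : n ≤ level y)
    (hz : z ∈ declared y) (hw : w ∈ declared y) : Near z w :=
  or_iff_not_imp_left.2 ((h.linked_base hK hx₀ hn hy).declared_declared (by omega) hz hw)

theorem Reach.near_declared {y z : ℕ} (h : Reach K n y) (hy : n ≤ level y)
    (hz : z ∈ declared y) : Near y z := by
  have hlt := level_lt_of_mem_declared hz
  refine Or.inr (Linked.symm (Linked.intro (by rintro rfl; omega) (fun _ => ⟨?_, ?_, Or.inl hz⟩)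
    fun h => absurd h (by omega)))
  · exact fun w hw hwz => (h.near_of_declared hK hx₀ hn hy hw hz).linked hwz
  · exact fun w hw u hu hwu => (h.near_of_declared hK hx₀ hn hy hw hu).linked hwu

theorem Reach.near_of_near {k l u : ℕ} (hl : Reach K n l) (hkl : Near k l)
    (hle : level k ≤ level l) (hln : n ≤ level l) (hu : u ∈ declared l) : Near k u := by
  rcases hkl with rfl | hkl
  · exact hl.near_declared hK hx₀ hn hln hu
  · by_cases huk : k = u
    · exact Or.inl huk
    · exact Or.inr (hkl.declared_left hle hu (Ne.symm huk)).symm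

/-- Nearness descends: if `k` and `l` are near, so are the vertices of level at most `n` reached
from them. -/
theorem Reach.near_of_low {k l a b : ℕ} (hk : Reach K n k) (hl : Reach K n l) (hkl : Near k l)
    (ha : Low n k a) (hb : Low n l b) : Near a b := by
  induction hN : level k + level l using Nat.strong_induction_on generalizing k l a b with
  | _ N ih =>
    subst hN
    -- descending on the side of the higher level preserves nearness
    have right : ∀ {u}, level k ≤ level l → n ≤ level l → u ∈ declared l → Low n u b →
        Near a b := fun {u} hle hln hu hub =>
      ih _ (by have := level_lt_of_mem_declared hu; omega) hk (hl.step hln hu)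
        (hl.near_of_near hK hx₀ hn hkl hle hln hu) ha hub rfl
    have left : ∀ {u}, level l ≤ level k → n ≤ level k → u ∈ declared k → Low n u a →
        Near a b := fun {u} hle hkn hu hua =>
      ih _ (by have := level_lt_of_mem_declared hu; omega) (hk.step hkn hu) hl
        (hk.near_of_near hK hx₀ hn hkl.symm hle hkn hu).symm hua hb rfl
    cases ha with
    | self hka =>
      cases hb with
      | self _ => exact hkl
      | step hln hu hub => exact right (hka.trans hln) hln hu hub
    | step hkn hu hua =>
      cases hb with
      | self hlb => exact left (hlb.trans hkn) hkn hu hua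
      | step hln hu' hub =>
        rcases le_total (level k) (level l) with h | h
        · exact right h hln hu' hub
        · exact left h hkn hu hua

/-- The reachable vertices of level at most `n` form a clique. -/
theorem Reach.near {a b : ℕ} (ha : Reach K n a) (hb : Reach K n b) (han : level a ≤ n)
    (hbn : level b ≤ n) : Near a b := by
  obtain ⟨k, hk, hka⟩ := ha.exists_low han
  obtain ⟨l, hl, hlb⟩ := hb.exists_low hbn
  exact near_of_low hK hx₀ hn (.base hk) (.base hl) (hK.near hk hl) hka hlb

/-- Only finitely many reachable vertices below level `n` are on levels whose function is not
total: along a clique within one level, that function converges further and further. -/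
theorem finite_reach_not_total :
    {z | Reach K n z ∧ level z < n ∧ ¬ TotalLevel (level z)}.Finite := by
  have : {z | Reach K n z ∧ level z < n ∧ ¬ TotalLevel (level z)} ⊆
      ⋃ m ∈ Finset.range n, {z | Reach K n z ∧ level z = m ∧ level z < n ∧ ¬ TotalLevel m} := by
    rintro z ⟨h₁, h₂, h₃⟩
    exact Set.mem_biUnion (Finset.mem_coe.2 (Finset.mem_range.2 h₂)) ⟨h₁, rfl, h₂, h₃⟩
  refine Set.Finite.subset (Set.Finite.biUnion (Finset.finite_toSet _) fun m _ => ?_) this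
  rcases Set.subsingleton_or_nontrivial
    {z | Reach K n z ∧ level z = m ∧ level z < n ∧ ¬ TotalLevel m} with h | h
  · exact h.finite
  · obtain ⟨z, -, -, -, hm⟩ := h.nonempty
    obtain ⟨y, hy⟩ := not_forall.1 hm
    refine (Set.finite_Iio y).subset fun w hw => ?_
    obtain ⟨u, hu, huw⟩ := h.exists_ne w
    obtain ⟨t, ht⟩ := ((hu.1.near hK hx₀ hn hw.1 hu.2.2.1.le hw.2.2.1.le).linked
      huw).exists_linkedBy
    rcases ht.mem_or_convBy (by rw [hu.2.1, hw.2.1]) with h | h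
    · have := level_lt_of_mem_declared h
      rw [hu.2.1, hw.2.1] at this
      omega
    · rw [hu.2.1] at h
      by_contra hyw
      rw [Set.mem_Iio, not_lt] at hyw
      exact hy ⟨t, h.of_le (by omega)⟩

/-- The vertex on a total level `n` which declares exactly the reachable vertices on lower levels
that are not total is linked to all other reachable vertices. -/
theorem exists_mem_level_eq (hT : TotalLevel n) :
    ∃ v ∈ K, level v = n ∧ ∀ z ∈ declared v, ¬ TotalLevel (level z) := by
  have hfin := finite_reach_not_total hK hx₀ hn
  let v := Nat.pair n (Encodable.encode hfin.toFinset.toList)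
  have hlv : level v = n := by simp [level, v]
  have hdv : ∀ z, z ∈ declared v ↔ Reach K n z ∧ level z < n ∧ ¬ TotalLevel (level z) := by
    intro z
    simp only [declared, hlv, List.mem_filter]
    simp only [v, Nat.unpair_pair, Denumerable.ofNat_encode, Finset.mem_toList,
      Set.Finite.mem_toFinset, Set.mem_ofPred_eq, decide_eq_true_eq]
    tauto
  -- by induction on the level of `z`, since an edge from `v` to a vertex `z` above it requires
  -- edges from `v` to the vertices declared by `z`
  have key : ∀ z, Reach K n z → v ≠ z → Linked v z := by
    intro z
    induction hN : level z using Nat.strong_induction_on generalizing z with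
    | _ N ih =>
      subst hN
      intro hz hne
      refine Linked.intro hne (fun hle => ⟨fun w hw hwv => ?_, fun w hw u hu hwu => ?_, ?_⟩)
        fun hle => ⟨fun w hw hwz => ?_, fun w hw u hu hwu => ?_, ?_⟩
      · exact (ih _ (level_lt_of_mem_declared hw) w rfl (hz.step (hlv ▸ hle) hw) hwv.symm).symm
      · exact (hz.near_of_declared hK hx₀ hn (hlv ▸ hle) hw hu).linked hwu
      · exact Or.inr (hlv ▸ hT _)
      · have hw' := (hdv w).1 hw
        exact (hw'.1.near hK hx₀ hn hz hw'.2.1.le (hlv ▸ hle)).linked hwz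
      · have hw' := (hdv w).1 hw
        have hu' := (hdv u).1 hu
        exact (hw'.1.near hK hx₀ hn hu'.1 hw'.2.1.le hu'.2.1.le).linked hwu
      · by_cases hz' : TotalLevel (level z)
        · exact Or.inr (hz' _)
        · refine Or.inl ((hdv z).2 ⟨hz, lt_of_le_of_ne (hlv ▸ hle) fun h => hz' (h ▸ hT), hz'⟩)
  exact ⟨v, hK.mem v fun x hx => key x (.base hx), hlv, fun z hz => ((hdv z).1 hz).2.2⟩

end Reach

/-! ### Enumerations of maximal cliques are not computably bounded -/

/-- The function `h` is attached to level `n`. -/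
def Computes (n : ℕ) (h : ℕ → ℕ) : Prop := ∀ i, h i ∈ (levelCode n).eval i

theorem exists_computes {h : ℕ → ℕ} (hh : Computable h) (m : ℕ) : ∃ n ≥ m, Computes n h := by
  obtain ⟨c, hc⟩ := Code.exists_code.1 (Partrec.nat_iff.1 hh.partrec)
  refine ⟨Nat.pair (Encodable.encode c) m, Nat.right_le_pair _ _, fun i => ?_⟩
  simp [levelCode, hc]

theorem Computes.totalLevel {n : ℕ} {h : ℕ → ℕ} (hn : Computes n h) : TotalLevel n := by
  intro y
  induction y with
  | zero =>
    obtain ⟨s, hs⟩ := Code.evaln_complete.1 (hn 0)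
    refine ⟨max s (h 0 + 1), fun i hi => ⟨h 0, by omega, ?_⟩⟩
    obtain rfl : i = 0 := by omega
    exact Code.evaln_mono (le_max_left _ _) hs
  | succ y ih =>
    obtain ⟨t, ht⟩ := ih
    obtain ⟨s, hs⟩ := Code.evaln_complete.1 (hn (y + 1))
    refine ⟨max t (max s (h (y + 1) + 1)), fun i hi => ?_⟩
    rcases Nat.lt_succ_iff_lt_or_eq.1 hi with hi | rfl
    · exact (ht.mono (le_max_left _ _)) i hi
    · exact ⟨h (y + 1), by omega, Code.evaln_mono (by omega) hs⟩

theorem Computes.lt_of_convBy {n s y k : ℕ} {h : ℕ → ℕ} (hn : Computes n h)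
    (hs : ConvBy s n y) (hk : k ≤ y) : h k < s := by
  obtain ⟨a, ha, hka⟩ := hs k (by omega)
  rwa [Part.mem_unique (hn k) (Code.evaln_sound hka)]

/-- If `h` is attached to the level of `v`, then edges from `v` to vertices of higher level that
do not declare `v` appear late. -/
theorem Computes.not_linkedBy {v x k : ℕ} {h : ℕ → ℕ} (hv : Computes (level v) h)
    (hle : level v ≤ level x) (hvx : v ∉ declared x) (hk : k ≤ level x + 1) :
    ¬ LinkedBy (h k) v x := by
  intro H
  have hx : level x ≤ x := Nat.unpair_left_le x
  exact lt_irrefl _ (hv.lt_of_convBy ((H.mem_or_convBy hle).resolve_left hvx) (by omega))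

theorem IsMaximalClique.exists_mem_level_ge {K : Set ℕ} (hK : IsMaximalClique K)
    (m : ℕ) : ∃ v ∈ K, m ≤ level v := by
  obtain ⟨x₀, hx₀⟩ : K.Nonempty := by
    by_contra h
    rw [Set.not_nonempty_iff_eq_empty] at h
    subst h
    exact hK.mem 0 (by simp)
  obtain ⟨n, hnm, hn⟩ := exists_computes (Computable.const 0) (max m (level x₀ + 1))
  obtain ⟨v, hv, hvn, -⟩ := exists_mem_level_eq hK hx₀ (n := n) (by omega) hn.totalLevel
  exact ⟨v, hv, by omega⟩

/-- Let `b` enumerate a maximal clique. Then the stage by which the elements enumerated up to the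
first one of level at least `k` are seen to be pairwise linked is, as a function of `k`, not
computably bounded. -/
theorem IsMaximalClique.not_computably_bounded {b : ℕ → ℕ} (hK : IsMaximalClique (Set.range b))
    {h : ℕ → ℕ} (hh : Computable h) :
    ¬ ∀ k I, k ≤ level (b I) → (∀ i < I, level (b i) < k) →
      ∀ i ≤ I, ∀ j ≤ I, b i ≠ b j → LinkedBy (h k) (b i) (b j) := by
  classical
  intro H
  have hex : ∀ k, ∃ i, k ≤ level (b i) := fun k => by
    obtain ⟨_, ⟨i, rfl⟩, hi⟩ := hK.exists_mem_level_ge k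
    exact ⟨i, hi⟩
  -- `S k` consists of the elements enumerated up to the first one of level at least `k`
  let S : ℕ → Set ℕ := fun k => {x | ∃ i ≤ Nat.find (hex k), b i = x}
  have hlink : ∀ k, ∀ x ∈ S k, ∀ y ∈ S k, x ≠ y → LinkedBy (h k) x y := by
    rintro k _ ⟨i, hi, rfl⟩ _ ⟨j, hj, rfl⟩ hij
    exact H k _ (Nat.find_spec (hex k)) (fun i hi => not_le.1 (Nat.find_min (hex k) hi))
      i hi j hj hij
  have hmono : ∀ {j k}, j ≤ k → S j ⊆ S k := by
    rintro j k hjk _ ⟨i, hi, rfl⟩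
    exact ⟨i, hi.trans (Nat.find_min' _ (hjk.trans (Nat.find_spec (hex k)))), rfl⟩
  have hS : ∀ k, ∃ x ∈ S k, k ≤ level x := fun k => ⟨_, ⟨_, le_rfl, rfl⟩, Nat.find_spec (hex k)⟩
  have hmem : ∀ x ∈ Set.range b, ∃ k, x ∈ S k := by
    rintro _ ⟨i, rfl⟩
    refine ⟨(Finset.range (i + 1)).sup (fun j => level (b j)) + 1, i, ?_, rfl⟩
    refine (Nat.le_find_iff _ _).2 fun m hm => not_le.2 (Nat.lt_succ_of_le ?_)
    exact Finset.le_sup (f := fun j => level (b j)) (Finset.mem_range.2 (by omega))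
  -- two elements `v₀` and `v` of levels to which `h` is attached, neither declared by the other
  obtain ⟨n₀, hn₀, hc₀⟩ := exists_computes hh (level (b 0) + 1)
  obtain ⟨v₀, hv₀, rfl, -⟩ :=
    exists_mem_level_eq hK ⟨0, rfl⟩ (n := n₀) (by omega) hc₀.totalLevel
  obtain ⟨k₀, hk₀⟩ := hmem v₀ hv₀
  obtain ⟨n, hn, hc⟩ := exists_computes hh (max (level v₀ + 1) k₀)
  obtain ⟨v, hv, rfl, hvd⟩ :=
    exists_mem_level_eq hK ⟨0, rfl⟩ (n := n) (by omega) hc.totalLevel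
  have hv₀v : v₀ ∉ declared v := fun h => hvd _ h hc₀.totalLevel
  obtain ⟨k₁, hk₁⟩ := hmem v hv
  -- some elements of high level enumerated early do not declare `v`: otherwise `v` would be
  -- linked early to `v₀`, or to the element found for the preceding bound
  have key : ∀ j ≥ level v + 1, ∃ x ∈ S j, j ≤ level x ∧ v ∉ declared x := by
    intro j hj
    induction j, hj using Nat.le_induction with
    | base =>
      obtain ⟨x, hx, hjx⟩ := hS (level v + 1)
      refine ⟨x, hx, hjx, fun hvx => ?_⟩
      have h₁ := hlink _ v₀ (hmono (by omega) hk₀) x hx (by rintro rfl; omega)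
      exact hc₀.not_linkedBy (by omega) hv₀v le_rfl
        (h₁.declared_left (by omega) hvx (by rintro rfl; omega)).symm
    | succ j hj ih =>
      obtain ⟨x, hx, hjx, hvx⟩ := ih
      by_cases hx' : j + 1 ≤ level x
      · exact ⟨x, hmono (by omega) hx, hx', hvx⟩
      obtain ⟨y, hy, hjy⟩ := hS (j + 1)
      refine ⟨y, hy, hjy, fun hvy => ?_⟩
      have h₁ := hlink _ x (hmono (by omega) hx) y hy (by rintro rfl; omega)
      exact hc.not_linkedBy (by omega) hvx (by omega)
        (h₁.declared_left (by omega) hvy (by rintro rfl; omega))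
  obtain ⟨x, hx, hjx, hvx⟩ := key (max (level v + 1) k₁) (le_max_left _ _)
  exact hc.not_linkedBy (by omega) hvx (by omega)
    (hlink _ v (hmono (le_max_right _ _) hk₁) x hx (by rintro rfl; omega))

end LinkGraph

end SOA

namespace SOA

open Formula Oracle LinkGraph

/-! ### The family of sets attached to the graph -/

/-- The pairing function `(i, x) = (i + x)² + i` used to code families. -/
def famCode (i x : ℕ) : ℕ := (i + x) * (i + x) + i

/-- The first component of a code. -/
def famFst (y : ℕ) : ℕ := y - Nat.sqrt y * Nat.sqrt y

/-- The second component of a code. -/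
def famSnd (y : ℕ) : ℕ := Nat.sqrt y - famFst y

theorem sqrt_famCode (i x : ℕ) : Nat.sqrt (famCode i x) = i + x :=
  Nat.sqrt_add_eq _ (by omega)

@[simp] theorem famFst_famCode (i x : ℕ) : famFst (famCode i x) = i := by
  rw [famFst, sqrt_famCode, famCode, Nat.add_sub_cancel_left]

@[simp] theorem famSnd_famCode (i x : ℕ) : famSnd (famCode i x) = x := by
  rw [famSnd, sqrt_famCode, famFst_famCode, Nat.add_sub_cancel_left]

theorem primrec_famFst : Primrec famFst :=
  Primrec.nat_sub.comp Primrec.id (Primrec.nat_mul.comp Primrec.nat_sqrt Primrec.nat_sqrt)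

theorem primrec_famSnd : Primrec famSnd := Primrec.nat_sub.comp Primrec.nat_sqrt primrec_famFst

theorem primrec_famCode : Primrec₂ famCode :=
  Primrec.nat_add.comp (Primrec.nat_mul.comp (Primrec.nat_add.comp Primrec.fst Primrec.snd)
    (Primrec.nat_add.comp Primrec.fst Primrec.snd)) Primrec.fst

/-- `x` belongs to the set attached to the vertex `i`: either `x = 2 * i` is the tag of this set,
or `x = 2 * ⟨c, a, b⟩ + 1`, where `c` witnesses that `a` and `b` are linked and `i` is one of them.
Distinct sets of the family have different tags, and intersect iff their vertices are linked. -/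
def InFamily (i x : ℕ) : Prop :=
  x = 2 * i ∨ x % 2 = 1 ∧
    IsWitness (x / 2).unpair.1 (x / 2).unpair.2.unpair.1 (x / 2).unpair.2.unpair.2 ∧
    (i = (x / 2).unpair.2.unpair.1 ∨ i = (x / 2).unpair.2.unpair.2)

theorem inFamily_tag {i j : ℕ} : InFamily i (2 * j) ↔ i = j := by
  simp only [InFamily, Nat.mul_mod_right]
  omega

theorem exists_inFamily_and {i j : ℕ} (hij : i ≠ j) :
    (∃ x, InFamily i x ∧ InFamily j x) ↔ Linked i j := by
  constructor
  · rintro ⟨x, hi | ⟨hx, hw, hi⟩, hj | ⟨hx', -, hj⟩⟩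
    · omega
    · omega
    · omega
    · rcases hi with hi | hi <;> rcases hj with hj | hj
      · exact absurd (hi.trans hj.symm) hij
      · exact hi ▸ hj ▸ ⟨_, hw⟩
      · exact Linked.symm (hi ▸ hj ▸ ⟨_, hw⟩)
      · exact absurd (hi.trans hj.symm) hij
  · rintro ⟨c, hc⟩
    have h₁ : (2 * Nat.pair c (Nat.pair i j) + 1) / 2 = Nat.pair c (Nat.pair i j) := by omega
    refine ⟨2 * Nat.pair c (Nat.pair i j) + 1, Or.inr ⟨by omega, ?_⟩, Or.inr ⟨by omega, ?_⟩⟩ <;>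
      simpa [h₁] using hc

theorem primrecPred_inFamily {α : Type} [Primcodable α] {i x : α → ℕ} (hi : Primrec i)
    (hx : Primrec x) : PrimrecPred fun a => InFamily (i a) (x a) := by
  have hu₁ : Primrec fun n : ℕ => n.unpair.1 := Primrec.fst.comp Primrec.unpair
  have hu₂ : Primrec fun n : ℕ => n.unpair.2 := Primrec.snd.comp Primrec.unpair
  have hd : Primrec fun a => x a / 2 := Primrec.nat_div.comp hx (Primrec.const 2)
  have hd₁ := hu₁.comp (hu₂.comp hd)
  have hd₂ := hu₂.comp (hu₂.comp hd)
  exact (Primrec.eq.comp hx (Primrec.nat_mul.comp (Primrec.const 2) hi)).or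
    ((Primrec.eq.comp (Primrec.nat_mod.comp hx (Primrec.const 2)) (Primrec.const 1)).and
      ((primrecPred_isWitness.comp ((hu₁.comp hd).pair (hd₁.pair hd₂))).and
        ((Primrec.eq.comp hi hd₁).or (Primrec.eq.comp hi hd₂))))

/-- The set coding the family attached to the graph. -/
def graphFamily : Set ℕ := {y | famCode (famFst y) (famSnd y) = y ∧ InFamily (famFst y) (famSnd y)}

theorem famCode_mem_graphFamily {i x : ℕ} : famCode i x ∈ graphFamily ↔ InFamily i x := by
  simp [graphFamily]

/-! ### Failure of the intersection principle -/

theorem IsGeneric.mem_model_of_primrec {G : Oracle} (hG : IsGeneric G) (m : ℕ) {p q : ℕ → Prop}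
    {e : ℕ → ℕ} (hp : PrimrecPred p) (hq : PrimrecPred q) (he : Primrec e) :
    {y | p y ∨ q y ∧ e y ∈ G.col m} ∈ G.model := by
  refine hG.mem_model (A := fun H y => p y ∨ q y ∧ H m (e y) = true)
    (B := fun H y => ¬ p y ∧ (¬ q y ∨ H m (e y) = false)) (c := m + 1)
    (.or (.of_primrec hp) (.and (.of_primrec hq) (.get (Primrec.const m) he true)))
    (.and (.of_primrec hp.not) (.or (.of_primrec hq.not) (.get (Primrec.const m) he false)))
    ?_ ?_ fun x => ?_
  · intro H H' h y
    simp only [h m (Nat.lt_succ_self m), imp_self]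
  · intro H H' h y
    simp only [h m (Nat.lt_succ_self m), imp_self]
  · simp only [not_or, not_and, Bool.not_eq_true, imp_iff_not_or]

theorem satisfies_D2IP_iff (M : Set (Set ℕ)) : Satisfies M D2IP ↔
    ∀ A ∈ M, (∃ i x, famCode i x ∈ A) → ∃ B ∈ M,
      (∀ i, ∃ j, ∀ x, famCode i x ∈ B ↔ famCode j x ∈ A) ∧
      (∀ i j, (¬ ∀ x, famCode i x ∈ B ↔ famCode j x ∈ B) →
        ∃ x, famCode i x ∈ B ∧ famCode j x ∈ B) ∧
      ∀ C ∈ M, (∀ i, ∃ j, ∀ x, famCode i x ∈ C ↔ famCode j x ∈ A) ∧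
        (∀ i j, (¬ ∀ x, famCode i x ∈ C ↔ famCode j x ∈ C) →
          ∃ x, famCode i x ∈ C ∧ famCode j x ∈ C) ∧
        (∀ i, ∃ j, ∀ x, famCode i x ∈ B ↔ famCode j x ∈ C) →
        ∀ i, ∃ j, ∀ x, famCode i x ∈ C ↔ famCode j x ∈ B := by
  simp only [Satisfies, D2IP, nontrivialFamily, maximalSubfamilyD2, subfamily, intersectionD2,
    eqAt, memAt, pairT, realize_allS, realize_exS, realize_imp, realize_and, realize_allN,
    realize_exN, realize_iff, realize_neg, realize_mem, Term.eval_add, Term.eval_mul,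
    Term.eval_var, Term.eval_wk]
  exact Iff.rfl

theorem IsGeneric.not_satisfies_D2IP {G : Oracle} (hG : IsGeneric G) :
    ¬ Satisfies G.model D2IP := by
  classical
  rw [satisfies_D2IP_iff]
  intro H
  have hdec : Primrec fun y => famCode (famFst y) (famSnd y) :=
    primrec_famCode.comp primrec_famFst primrec_famSnd
  have hA : graphFamily ∈ G.model := by
    have := hG.mem_model_of_primrec 0
      ((Primrec.eq.comp hdec Primrec.id).and (primrecPred_inFamily primrec_famFst primrec_famSnd))
      (q := fun _ => False) (primrecPred_iff_primrec_decide.2 (Primrec.const _)) Primrec.id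
    simpa [graphFamily] using this
  obtain ⟨_, ⟨m, rfl⟩, hsub, hint, hmax⟩ := H _ hA ⟨0, 0, famCode_mem_graphFamily.2 (Or.inl rfl)⟩
  simp only [famCode_mem_graphFamily] at hsub hmax
  -- `b` enumerates the vertices whose sets occur in the maximal subfamily
  choose b hb using hsub
  have htag : ∀ i j, famCode i (2 * j) ∈ G.col m ↔ b i = j := fun i j => by
    rw [hb, inFamily_tag]
  have hrange : ∀ i j, b i ≠ b j → Linked (b i) (b j) := by
    intro i j hij
    obtain ⟨x, hx⟩ := hint i j fun h => hij (by
      have := (h (2 * b j)).2 ((htag j _).2 rfl)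
      exact (htag i _).1 this)
    exact (exists_inFamily_and hij).1 ⟨x, (hb i x).1 hx.1, (hb j x).1 hx.2⟩
  have hK : IsMaximalClique (Set.range b) := by
    refine ⟨?_, fun v hv => ?_⟩
    · rintro _ ⟨i, rfl⟩ _ ⟨j, rfl⟩ hij
      exact hrange i j hij
    · -- the family with the set of `v` put in front of the given one
      let C : Set ℕ := {y | (famCode (famFst y) (famSnd y) = y ∧ famFst y = 0 ∧
        InFamily v (famSnd y)) ∨ (famCode (famFst y) (famSnd y) = y ∧ famFst y ≠ 0) ∧
        famCode (famFst y - 1) (famSnd y) ∈ G.col m}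
      have hC : C ∈ G.model := hG.mem_model_of_primrec m
        ((Primrec.eq.comp hdec Primrec.id).and
          ((Primrec.eq.comp primrec_famFst (Primrec.const 0)).and
            (primrecPred_inFamily (Primrec.const v) primrec_famSnd)))
        ((Primrec.eq.comp hdec Primrec.id).and
          (Primrec.eq.comp primrec_famFst (Primrec.const 0)).not)
        (primrec_famCode.comp (Primrec.pred.comp primrec_famFst) primrec_famSnd)
      let b' : ℕ → ℕ := fun i => Nat.casesOn i v b
      have hC0 : ∀ x, famCode 0 x ∈ C ↔ InFamily v x := fun x => by simp [C]
      have hCs : ∀ i x, famCode (i + 1) x ∈ C ↔ famCode i x ∈ G.col m := fun i x => by simp [C]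
      have hCb : ∀ i x, famCode i x ∈ C ↔ InFamily (b' i) x := by
        rintro (_ | i) x
        · exact hC0 x
        · rw [hCs, hb]
      have hlink : ∀ i j, b' i ≠ b' j → Linked (b' i) (b' j) := by
        rintro (_ | i) (_ | j) hij
        · exact absurd rfl hij
        · exact hv _ ⟨j, rfl⟩ hij
        · exact (hv _ ⟨i, rfl⟩ hij.symm).symm
        · exact hrange i j hij
      obtain ⟨j, hj⟩ := hmax C hC ⟨fun i => ⟨b' i, hCb i⟩, fun i j hne => by
        simp only [hCb] at hne ⊢
        exact (exists_inFamily_and fun h => hne (by simp [h])).2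
          (hlink i j fun h => hne (by simp [h])), fun i => ⟨i + 1, fun x => (hCs i x).symm⟩⟩ 0
      have := (hj (2 * v)).1 ((hC0 _).2 (inFamily_tag.2 rfl))
      exact ⟨j, (htag _ _).1 this⟩
  -- the `Σ⁰₁` search for the initial segment of the enumeration up to the first element of level
  -- at least `k`, and for a stage at which its elements are seen to be pairwise linked
  let P : Oracle → ℕ × ℕ → Prop := fun H q => ∃ l : ℕ,
    let L := Denumerable.ofNat (List ℕ) l
    (∀ i < L.length, H 0 (famCode i (2 * L.getD i 0)) = true) ∧ 0 < L.length ∧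
    q.1 ≤ level (L.getD (L.length - 1) 0) ∧
    (∀ i < L.length - 1, level (L.getD i 0) < q.1) ∧
    ∀ i < L.length, ∀ j < L.length, L.getD i 0 ≠ L.getD j 0 →
      LinkedBy q.2 (L.getD i 0) (L.getD j 0)
  have hP : SigmaOne P := by
    have hget : Primrec₂ fun (q : (ℕ × ℕ) × ℕ) i => (Denumerable.ofNat (List ℕ) q.2).getD i 0 :=
      (Primrec.list_getD 0).comp ((Primrec.ofNat _).comp (Primrec.snd.comp Primrec.fst))
        Primrec.snd
    have hlen : Primrec fun q : (ℕ × ℕ) × ℕ => (Denumerable.ofNat (List ℕ) q.2).length :=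
      Primrec.list_length.comp ((Primrec.ofNat _).comp Primrec.snd)
    have hk : Primrec fun q : (ℕ × ℕ) × ℕ => q.1.1 := Primrec.fst.comp Primrec.fst
    have hlast : Primrec fun q : (ℕ × ℕ) × ℕ => (Denumerable.ofNat (List ℕ) q.2).length - 1 :=
      Primrec.pred.comp hlen
    refine SigmaOne.ex (.and ?_ (.of_primrec (.and ?_ (.and ?_ (.and ?_ ?_)))))
    · exact SigmaOne.ball (P := fun H (q : (ℕ × ℕ) × ℕ) i =>
        H 0 (famCode i (2 * (Denumerable.ofNat (List ℕ) q.2).getD i 0)) = true)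
        (.get (Primrec.const 0) (primrec_famCode.comp Primrec.snd
          (Primrec.nat_mul.comp (Primrec.const 2) hget)) true) hlen
    · exact Primrec.nat_lt.comp (Primrec.const 0) hlen
    · exact Primrec.nat_le.comp hk (primrec_level.comp (hget.comp Primrec.id hlast))
    · exact primrecPred_forall_lt (R := fun (q : (ℕ × ℕ) × ℕ) i =>
        level ((Denumerable.ofNat (List ℕ) q.2).getD i 0) < q.1.1) hlast
        (Primrec.nat_lt.comp (primrec_level.comp hget) (hk.comp Primrec.fst))
    · refine primrecPred_forall_lt (R := fun (q : (ℕ × ℕ) × ℕ) i =>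
        ∀ j < (Denumerable.ofNat (List ℕ) q.2).length,
          (Denumerable.ofNat (List ℕ) q.2).getD i 0 ≠ (Denumerable.ofNat (List ℕ) q.2).getD j 0 →
          LinkedBy q.1.2 ((Denumerable.ofNat (List ℕ) q.2).getD i 0)
            ((Denumerable.ofNat (List ℕ) q.2).getD j 0)) hlen ?_
      refine primrecPred_forall_lt (f := fun q : ((ℕ × ℕ) × ℕ) × ℕ =>
          (Denumerable.ofNat (List ℕ) q.1.2).length) (R := fun q j =>
          (Denumerable.ofNat (List ℕ) q.1.2).getD q.2 0 ≠
            (Denumerable.ofNat (List ℕ) q.1.2).getD j 0 →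
          LinkedBy q.1.1.2 ((Denumerable.ofNat (List ℕ) q.1.2).getD q.2 0)
            ((Denumerable.ofNat (List ℕ) q.1.2).getD j 0)) (hlen.comp Primrec.fst) ?_
      have hi := hget.comp (Primrec.fst.comp Primrec.fst : Primrec fun q :
        (((ℕ × ℕ) × ℕ) × ℕ) × ℕ => q.1.1) (Primrec.snd.comp Primrec.fst)
      have hj := hget.comp (Primrec.fst.comp Primrec.fst : Primrec fun q :
        (((ℕ × ℕ) × ℕ) × ℕ) × ℕ => q.1.1) Primrec.snd
      exact primrecPred_imp (Primrec.eq.comp hi hj).not (primrecPred_linkedBy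
        (Primrec.snd.comp (Primrec.fst.comp (Primrec.fst.comp Primrec.fst))) hi hj)
  have hlist : ∀ I i, i < I + 1 → ((List.range (I + 1)).map b).getD i 0 = b i := by
    intro I i hi
    simp [List.getD_eq_getElem?_getD, List.getElem?_range hi]
  obtain ⟨h, hh, hbound⟩ := hG.bounded_column m hP (by
    intro k
    have hex : ∃ i, k ≤ level (b i) := by
      obtain ⟨_, ⟨i, rfl⟩, hi⟩ := hK.exists_mem_level_ge k
      exact ⟨i, hi⟩
    let I := Nat.find hex
    have hst : ∀ i j, ∃ t, b i ≠ b j → LinkedBy t (b i) (b j) := by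
      intro i j
      by_cases hij : b i = b j
      · exact ⟨0, fun h => absurd hij h⟩
      · obtain ⟨t, ht⟩ := (hK.linked _ ⟨i, rfl⟩ _ ⟨j, rfl⟩ hij).exists_linkedBy
        exact ⟨t, fun _ => ht⟩
    choose t ht using hst
    refine ⟨(Finset.range (I + 1) ×ˢ Finset.range (I + 1)).sup fun p => t p.1 p.2,
      Encodable.encode ((List.range (I + 1)).map b), ?_⟩
    simp only [Denumerable.ofNat_encode, List.length_map, List.length_range, Nat.add_sub_cancel]
    refine ⟨fun i hi => ?_, by omega, ?_, fun i hi => ?_, fun i hi j hj hij => ?_⟩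
    · rw [hlist I i hi]
      exact (htag i (b i)).2 rfl
    · rw [hlist I I (by omega)]
      exact Nat.find_spec hex
    · rw [hlist I i (by omega)]
      exact not_le.1 (Nat.find_min hex hi)
    · rw [hlist I i hi, hlist I j hj] at hij ⊢
      refine (ht i j hij).mono ?_
      exact Finset.le_sup (f := fun p : ℕ × ℕ => t p.1 p.2) (b := (i, j))
        (by simp only [Finset.mem_product, Finset.mem_range]; exact ⟨hi, hj⟩))
  refine hK.not_computably_bounded hh fun k I hI hmin i hi j hj hij => ?_
  obtain ⟨s, hs, l, h₁, h₂, h₃, h₄, h₅⟩ := hbound k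
  set L := Denumerable.ofNat (List ℕ) l
  have hL : ∀ i < L.length, L.getD i 0 = b i := fun i hi => ((htag i _).1 (h₁ i hi)).symm
  have hIL : I = L.length - 1 := by
    rcases lt_trichotomy I (L.length - 1) with h | h | h
    · have := h₄ I h
      rw [hL I (by omega)] at this
      dsimp only at this
      omega
    · exact h
    · have := hmin _ h
      rw [hL _ (by omega)] at h₃
      dsimp only at h₃
      omega
  have := h₅ i (by omega) j (by omega)
  rw [hL i (by omega), hL j (by omega)] at this
  exact (this hij).mono hs

end SOA

theorem corollaryC :
    ¬ SOA.Provable SOA.WKL0 SOA.D2IP ∧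
      ∃ M : Set (Set ℕ), SOA.IsOmegaModel M SOA.WKL0 ∧
        (∀ X ∈ M, ¬ SOA.HasHyperimmuneDegree X) ∧ ¬ SOA.Satisfies M SOA.D2IP := by
  obtain ⟨G, hG⟩ := SOA.exists_isGeneric
  exact ⟨fun h => hG.not_satisfies_D2IP (h.satisfies hG.isOmegaModel_WKL0), G.model,
    hG.isOmegaModel_WKL0, hG.not_hasHyperimmuneDegree, hG.not_satisfies_D2IP⟩
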